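/- Let $\mathcal P$ be a stationary stochastic process $(X_t)_{t\in\mathbb Z}$ with values in a countable alphabet, with past $\overleftarrow X=\dots X_{-2}X_{-1}$ and future $\overrightarrow X=X_0X_1\dots$, and let $\mathcal P^-$ be its time reversal $Y_t=X_{-(t+1)}$. Two pasts are equivalent if they have the same conditional law of the future; the equivalence classes $s_i$ are the causal states, occurring with probabilities $\pi_i$. The classical statistical complexity is $C_\mu^+=-\sum_i\pi_i\log\pi_i\in[0,\infty]$ (it is $\infty$ if the law of the causal state is not discrete), $C_\mu^-$ is the classical statistical complexity of $\mathcal P^-$, $\Delta C_\mu=|C_\mu^--C_\mu^+|$ is the causal asymmetry, and $E=I(\overleftarrow X;\overrightarrow X)$ is the mutual information between past and future. A quantum causal model encodes each past $\overleftarrow x$ into a pure state $|s_{\overleftarrow x}\rangle$ of a Hilbert space and has a quantum measurement process which, applied to $|s_{\overleftarrow x}\rangle$ for almost every past, outputs each $x$ with probability $P(X_0=x\mid\overleftarrow X=\overleftarrow x)$ and then leaves the system in the state $|s_{\overleftarrow x x}\rangle$. Its entropy is the von Neumann entropy $-\operatorname{tr}(\rho\log\rho)$ of the average $\rho$ of $|s_{\overleftarrow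 x}\rangle\langle s_{\overleftarrow x}|$ over the law of the past. The quantum statistical complexity $C_q^+$ is the infimum of the entropies of all quantum causal models of $\mathcal P$. (a) If $C_\mu^+<\infty$ and $C_q^+=C_\mu^+$, then $C_\mu^+=C_\mu^-=E$. (b) If $\mathcal P$ is deterministic, i.e. $H(\overrightarrow X\mid\overleftarrow X)=0$ (meaning $H(X_0\dots X_{L-1}\mid\overleftarrow X)=0$ for every $L$), then $C_\mu^+=C_\mu^-$ (possibly both infinite), and so $\Delta C_\mu=0$. -/

import Mathlib

open MeasureTheory ProbabilityTheory
open scoped ENNReal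

namespace CausalAsymmetry

noncomputable section

/-! ### Stationary processes, pasts and futures

A process over the output alphabet `A` is a probability measure on the bi-infinite sequences
`ℤ → A`.  A past `… x₋₂ x₋₁` is stored as the sequence `k ↦ x₋₍ₖ₊₁₎`, a future `x₀ x₁ …` as the
sequence `k ↦ xₖ`. -/

section Trajectories

variable {A : Type*}

/-- The past `… x₋₂ x₋₁`, most recent symbol first. -/
def past (x : ℤ → A) : ℕ → A := fun k => x (-((k : ℤ) + 1))

/-- The future `x₀ x₁ …`. -/
def future (x : ℤ → A) : ℕ → A := fun k => x k

/-- The shift by one time step. -/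
def shift (x : ℤ → A) : ℤ → A := fun t => x (t + 1)

/-- Time reversal of a trajectory: `Y_t = X_{-(t+1)}`. -/
def reverse (x : ℤ → A) : ℤ → A := fun t => x (-(t + 1))

/-- The past `p a`: the past `p` followed by the new output `a`. -/
def appendOutput (p : ℕ → A) (a : A) : ℕ → A
  | 0 => a
  | k + 1 => p k

variable [MeasurableSpace A]

/-- Stationarity: the law is invariant under the time shift. -/
def IsStationary (P : Measure (ℤ → A)) : Prop := MeasurePreserving shift P P

theorem measurable_past : Measurable (past : (ℤ → A) → ℕ → A) :=
  measurable_pi_lambda _ fun _ => measurable_pi_apply _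

theorem measurable_future : Measurable (future : (ℤ → A) → ℕ → A) :=
  measurable_pi_lambda _ fun _ => measurable_pi_apply _

theorem measurable_reverse : Measurable (reverse : (ℤ → A) → ℤ → A) :=
  measurable_pi_lambda _ fun _ => measurable_pi_apply _

/-- The law of the time-reversed process. -/
def timeReversal (P : Measure (ℤ → A)) : Measure (ℤ → A) := P.map reverse

instance instIsProbabilityMeasureTimeReversal (P : Measure (ℤ → A)) [IsProbabilityMeasure P] :
    IsProbabilityMeasure (timeReversal P) :=
  Measure.isProbabilityMeasure_map measurable_reverse.aemeasurable

/-- The law `P(past)`. -/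
def pastLaw (P : Measure (ℤ → A)) : Measure (ℕ → A) := P.map past

/-- The law `P(future)`. -/
def futureLaw (P : Measure (ℤ → A)) : Measure (ℕ → A) := P.map future

/-- The joint law `P(past, future)`. -/
def jointLaw (P : Measure (ℤ → A)) : Measure ((ℕ → A) × (ℕ → A)) :=
  P.map fun x => (past x, future x)

end Trajectories

/-! ### Classical information measures (in nats) -/

/-- Shannon entropy `-∑ πᵢ log πᵢ` of a family of weights.  A family of weights that does not sum
to `1` (the masses of the cells of a partition that is not, up to a null set, countable) has
entropy `∞`. -/
def shannonEntropy {ι : Type*} (π : ι → ℝ≥0∞) : ℝ≥0∞ :=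
  open Classical in
  if ∑' i, π i = 1 then ∑' i, ENNReal.ofReal (Real.negMulLog (π i).toReal) else ⊤

section ClassicalModels

variable {A : Type*} [Countable A] [Nonempty A] [MeasurableSpace A] [DiscreteMeasurableSpace A]

/-- The regular conditional distribution `P(future | past = p)`. -/
def futureGivenPast (P : Measure (ℤ → A)) [IsProbabilityMeasure P] : Kernel (ℕ → A) (ℕ → A) :=
  condDistrib future past P

/-- `P(X₀ = a | past = p)`. -/
def outputProb (P : Measure (ℤ → A)) [IsProbabilityMeasure P] (p : ℕ → A) (a : A) : ℝ≥0∞ :=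
  futureGivenPast P p {y | y 0 = a}

/-- Two pasts are equivalent when they have the same conditional future. -/
def causalSetoid (P : Measure (ℤ → A)) [IsProbabilityMeasure P] : Setoid (ℕ → A) :=
  Setoid.ker fun p => futureGivenPast P p

/-- The causal states: equivalence classes of pasts. -/
def CausalState (P : Measure (ℤ → A)) [IsProbabilityMeasure P] : Type _ :=
  Quotient (causalSetoid P)

/-- The encoding `ε` of pasts into causal states. -/
def causalState (P : Measure (ℤ → A)) [IsProbabilityMeasure P] (p : ℕ → A) : CausalState P :=
  Quotient.mk (causalSetoid P) p

/-- The probability that the past lies in the causal state `s`. -/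
def causalProb (P : Measure (ℤ → A)) [IsProbabilityMeasure P] (s : CausalState P) : ℝ≥0∞ :=
  pastLaw P {p | causalState P p = s}

/-- The classical statistical complexity `C_μ`: the entropy of the causal states.  The
retrodictive complexity `C_μ^-` is `statisticalComplexity (timeReversal P)`. -/
def statisticalComplexity (P : Measure (ℤ → A)) [IsProbabilityMeasure P] : ℝ≥0∞ :=
  shannonEntropy (causalProb P)

/-- The causal asymmetry `|C_μ^- - C_μ^+|` (subtraction in `ℝ≥0∞` is truncated, so one of the two
differences is `0`). -/
def causalAsymmetry (P : Measure (ℤ → A)) [IsProbabilityMeasure P] : ℝ≥0∞ :=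
  max (statisticalComplexity (timeReversal P) - statisticalComplexity P)
    (statisticalComplexity P - statisticalComplexity (timeReversal P))

/-- The excess entropy `E = I(past; future)`: the mutual information of past and future. -/
def excessEntropy (P : Measure (ℤ → A)) : ℝ≥0∞ :=
  InformationTheory.klDiv (jointLaw P) ((pastLaw P).prod (futureLaw P))

/-- The conditional entropy `H(future | past)`: the supremum (limit) over `L` of the conditional
entropies `H(X₀ … X_{L-1} | past)`, each the average over the past `p` of the entropy of the
conditional distribution of the words `X₀ … X_{L-1}` given `p`. -/
def condEntropyFutureGivenPast (P : Measure (ℤ → A)) [IsProbabilityMeasure P] : ℝ≥0∞ :=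
  ⨆ L : ℕ, ∫⁻ p, shannonEntropy
    (fun w : Fin L → A => futureGivenPast P p {y | ∀ i : Fin L, y i = w i}) ∂(pastLaw P)

end ClassicalModels

/-! ### Quantum causal models -/

/-- The von Neumann entropy `-tr (ρ log ρ) = -∑ λᵢ log λᵢ` of a density operator, the sum running
over the eigenvalues counted with multiplicity.  (A density operator is compact, so its nonzero
eigenvalues have finite multiplicity and determine it; the eigenvalue `0` contributes `0`.) -/
def vonNeumannEntropy {H : Type*} [NormedAddCommGroup H] [InnerProductSpace ℂ H]
    (ρ : H →L[ℂ] H) : ℝ≥0∞ :=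
  ∑' l : ℝ, (Module.finrank ℂ (Module.End.eigenspace (ρ : H →ₗ[ℂ] H) (l : ℂ)) : ℝ≥0∞) *
    ENNReal.ofReal (Real.negMulLog l)

section QuantumModels

variable {A : Type*} [Countable A] [Nonempty A] [MeasurableSpace A] [DiscreteMeasurableSpace A]

/-- A quantum causal model of the process `P`: an encoding of pasts into pure states of a Hilbert
space, and a quantum measurement process with outcomes in `A`, given by its Kraus operators
(outcome `a` sends `ρ` to `∑ₖ K_{a,k} ρ K_{a,k}†`), which, applied to the state of (almost) every
past `p`, outputs `a` with probability `P(X₀ = a | past = p)` and then leaves the system in the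
state of the past `p a`. -/
structure QuantumModel (P : Measure (ℤ → A)) [IsProbabilityMeasure P] where
  /-- the Hilbert space of the memory -/
  H : Type
  [normedAddCommGroup : NormedAddCommGroup H]
  [innerProductSpace : InnerProductSpace ℂ H]
  [completeSpace : CompleteSpace H]
  /-- the encoding function: a unit vector for every past -/
  state : (ℕ → A) → H
  norm_state : ∀ p, ‖state p‖ = 1
  stronglyMeasurable_state : StronglyMeasurable state
  /-- the Kraus operators of the measurement process, sorted by outcome -/
  kraus : A → ℕ → H →L[ℂ] H
  /-- the process is trace preserving: `∑ K† K = 1` -/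
  trace_preserving : ∀ ψ : H, HasSum (fun i : A × ℕ => ‖kraus i.1 i.2 ψ‖ ^ 2) (‖ψ‖ ^ 2)
  /-- the outputs have the correct probabilities -/
  output : ∀ᵐ p ∂(pastLaw P), ∀ a,
    HasSum (fun k => ‖kraus a k (state p)‖ ^ 2) (outputProb P p a).toReal
  /-- after the output `a`, the system is in the pure state given by the vector `state (p a)` -/
  transition : ∀ᵐ p ∂(pastLaw P), ∀ a, outputProb P p a ≠ 0 →
    ∀ k, kraus a k (state p) ∈ Submodule.span ℂ {state (appendOutput p a)}

attribute [instance] QuantumModel.normedAddCommGroup QuantumModel.innerProductSpace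
  QuantumModel.completeSpace

/-- The average memory state `ρ = ∑ P(past = p) |s_p⟩⟨s_p|`, as an integral over the pasts. -/
def QuantumModel.averageState {P : Measure (ℤ → A)} [IsProbabilityMeasure P]
    (Q : QuantumModel P) : Q.H →L[ℂ] Q.H :=
  ∫ p, InnerProductSpace.rankOne ℂ (Q.state p) (Q.state p) ∂(pastLaw P)

/-- The entropy of a quantum model. -/
def QuantumModel.entropy {P : Measure (ℤ → A)} [IsProbabilityMeasure P]
    (Q : QuantumModel P) : ℝ≥0∞ :=
  vonNeumannEntropy Q.averageState

/-- The quantum statistical complexity `C_q`: the least entropy of a quantum causal model. -/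
def quantumComplexity (P : Measure (ℤ → A)) [IsProbabilityMeasure P] : ℝ≥0∞ :=
  ⨅ Q : QuantumModel P, Q.entropy

end QuantumModels

end

end CausalAsymmetry

open MeasureTheory ProbabilityTheory
open scoped ENNReal

namespace CausalAsymmetry

/-! ### Fibres and entropies -/

section Fibres

variable {Ω σ τ : Type*} [MeasurableSpace Ω] {μ : Measure Ω}

/-! Part (a) rests on co-unifilarity. Suppose two distinct causal states of positive probability can
both emit `x₀` and then pass to the same state. Encode state `i` as a superposition of pairs
(output, label of `i`), except that the output `x₀` of `i₂` carries the label of `i₁`. The forgotten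
label does not affect the next state, so this is still a valid model. Its memory vectors are
orthonormal apart from one overlap `c > 0`. The eigenvalues of the average state are then the state
probabilities, with two of them replaced by a more spread pair with the same sum, so strict
concavity makes the entropy drop strictly below `C_μ⁺` (`exists_quantumModel_entropy_lt`). Hence,
without quantum advantage, an output and the state after it determine the state before it.

By stationarity, the state at a late time `L` can be read, up to a small error, from the symbols `X₀
… X_{L-1}`. Co-unifilarity runs it back to time `0`, and Borel–Cantelli removes the error, so the
causal state is almost surely a function of the future (`exists_future_set`). Past and future are
independent given that state. So the conditional law of the past given the future is the past law
conditioned on the state, the forward and reverse states generate the same partition, and the joint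
law has density `1/πᵢ` on the block of state `i`. The two complexities and the mutual information
therefore agree.

In part (b) the conditional future is almost surely a point mass, so the causal state amounts to the
future itself. The retrodictive state also determines the future, because any typical past drawn
from it does. Both partitions are the partition by futures; neither finiteness nor stationarity is
needed. -/

theorem measure_fiber_eq {f : Ω → σ} {g : Ω → τ} {G : Set Ω}
    (hG : ∀ᵐ x ∂μ, x ∈ G) (h : ∀ x ∈ G, ∀ x' ∈ G, f x = f x' ↔ g x = g x') {x₀ : Ω} (hx₀ : x₀ ∈ G) :
    μ {x | f x = f x₀} = μ {x | g x = g x₀} := by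
  refine measure_congr ?_
  filter_upwards [hG] with x hx
  exact propext (h x hx x₀ hx₀)

theorem exists_mem_of_measure_fiber_ne_zero {f : Ω → σ} {G : Set Ω} (hG : ∀ᵐ x ∂μ, x ∈ G) {s : σ}
    (hs : μ {x | f x = s} ≠ 0) : ∃ x ∈ G, f x = s := by
  by_contra! hc
  refine hs (measure_mono_null (fun x hx hxG => hc x hxG hx) hG)

/-- Fibres of positive mass meet `G`, and choosing a point there matches the heavy values of `f`
with those of `g`. All other terms vanish because `φ 0 = 0`. A general `φ` serves both sums in
`shannonEntropy`. -/
theorem tsum_comp_measure_fiber {f : Ω → σ} {g : Ω → τ} {G : Set Ω}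
    (hG : ∀ᵐ x ∂μ, x ∈ G) (h : ∀ x ∈ G, ∀ x' ∈ G, f x = f x' ↔ g x = g x')
    (φ : ℝ≥0∞ → ℝ≥0∞) (hφ : φ 0 = 0) :
    ∑' s, φ (μ {x | f x = s}) = ∑' t, φ (μ {x | g x = t}) := by
  have key : ∀ t : Function.support fun t => φ (μ {x | g x = t}), ∃ x ∈ G, g x = t := fun t =>
    exists_mem_of_measure_fiber_ne_zero hG fun h0 => t.2 (by simp [h0, hφ])
  choose x hxG hx using key
  refine tsum_eq_tsum_of_ne_zero_bij (fun t => f (x t)) ?_ ?_ ?_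
  · intro t t' htt
    have := (h _ (hxG t) _ (hxG t')).1 htt
    rw [hx, hx] at this
    exact Subtype.ext this
  · intro s hs
    obtain ⟨z, hz, rfl⟩ := exists_mem_of_measure_fiber_ne_zero (f := f) (s := s) hG
      fun h0 => hs (by simp [h0, hφ])
    have hz' : g z ∈ Function.support fun t => φ (μ {x | g x = t}) := by
      rw [Function.mem_support, ← measure_fiber_eq hG h hz]
      exact hs
    exact ⟨⟨g z, hz'⟩, (h _ (hxG _) _ hz).2 (hx _)⟩
  · intro t
    rw [measure_fiber_eq hG h (hxG t), hx]

/-- Two variables that generate the same partition up to a null set have the same entropy. -/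
theorem shannonEntropy_fiber_congr {f : Ω → σ} {g : Ω → τ} {G : Set Ω}
    (hG : ∀ᵐ x ∂μ, x ∈ G) (h : ∀ x ∈ G, ∀ x' ∈ G, f x = f x' ↔ g x = g x') :
    shannonEntropy (fun s => μ {x | f x = s}) = shannonEntropy (fun t => μ {x | g x = t}) := by
  unfold shannonEntropy
  rw [tsum_comp_measure_fiber hG h (fun r => r) rfl,
    tsum_comp_measure_fiber hG h (fun r => ENNReal.ofReal (Real.negMulLog r.toReal)) (by simp)]

end Fibres

/-! ### Countably many sets determine a finite measure -/

/-- The algebra generated by a countable generating family is a countable π-system containing the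
whole space. It allows "for each set, almost everywhere" to become "almost everywhere, for all
sets". -/
theorem exists_countable_determining (β : Type*) [m : MeasurableSpace β]
    [MeasurableSpace.CountablyGenerated β] :
    ∃ C : Set (Set β), C.Countable ∧ (∀ B ∈ C, MeasurableSet B) ∧
      ∀ (μ ν : Measure β), IsFiniteMeasure μ → (∀ B ∈ C, μ B = ν B) → μ = ν := by
  obtain ⟨b, hb, hgen⟩ := MeasurableSpace.CountablyGenerated.isCountablyGenerated (α := β)
  have hgen' : m = MeasurableSpace.generateFrom (generateSetAlgebra b) := by
    rw [generateFrom_generateSetAlgebra_eq, hgen]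
  have halg := isSetAlgebra_generateSetAlgebra (𝒜 := b)
  refine ⟨generateSetAlgebra b, countable_generateSetAlgebra hb, fun B hB => ?_, ?_⟩
  · rw [hgen']
    exact MeasurableSpace.measurableSet_generateFrom hB
  · intro μ ν hμ h
    exact ext_of_generate_finite _ hgen' halg.isSetRing.isSetSemiring.isPiSystem h
      (h _ halg.univ_mem)

theorem ae_eq_of_forall_measurableSet {Ω β : Type*} [MeasurableSpace Ω] [MeasurableSpace β]
    [MeasurableSpace.CountablyGenerated β] {μ : Measure Ω} {f g : Ω → Measure β}
    (hf : ∀ x, IsFiniteMeasure (f x))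
    (h : ∀ B, MeasurableSet B → ∀ᵐ x ∂μ, f x B = g x B) : ∀ᵐ x ∂μ, f x = g x := by
  obtain ⟨C, hC, hCm, hdet⟩ := exists_countable_determining β
  have : ∀ᵐ x ∂μ, ∀ B ∈ C, f x B = g x B := (ae_ball_iff hC).2 fun B hB => h B (hCm B hB)
  filter_upwards [this] with x hx
  exact hdet _ _ (hf x) hx

theorem measurableSet_kernel_eq {Ω β : Type*} [MeasurableSpace Ω] [MeasurableSpace β]
    [MeasurableSpace.CountablyGenerated β] (k : Kernel Ω β) [IsFiniteKernel k] (ν : Measure β) :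
    MeasurableSet {p | k p = ν} := by
  obtain ⟨C, hC, hCm, hdet⟩ := exists_countable_determining β
  have : {p | k p = ν} = ⋂ B ∈ C, {p | k p B = ν B} := by
    ext p
    simp only [Set.mem_ofPred_eq, Set.mem_iInter]
    exact ⟨fun h B _ => by rw [h], fun h => hdet _ _ inferInstance h⟩
  rw [this]
  exact MeasurableSet.biInter hC fun B hB =>
    (k.measurable_coe (hCm B hB)) (measurableSet_singleton _)

/-! ### Disintegration -/

section Disintegration

variable {Ω α β : Type*} [MeasurableSpace Ω] [MeasurableSpace α] [MeasurableSpace β]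
  [StandardBorelSpace β] [Nonempty β] {μ : Measure Ω} [IsProbabilityMeasure μ]
  {X : Ω → α} {Y : Ω → β}

theorem lintegral_condDistrib (hX : Measurable X) (hY : Measurable Y) {f : α → β → ℝ≥0∞}
    (hf : Measurable (Function.uncurry f)) :
    ∫⁻ x, f (X x) (Y x) ∂μ = ∫⁻ p, ∫⁻ y, f p y ∂(condDistrib Y X μ p) ∂(μ.map X) := by
  have : IsProbabilityMeasure (μ.map X) := Measure.isProbabilityMeasure_map hX.aemeasurable
  have h := Measure.lintegral_compProd (μ := μ.map X) (κ := condDistrib Y X μ) hf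
  rw [compProd_map_condDistrib hY.aemeasurable, lintegral_map hf (hX.prodMk hY)] at h
  exact h

theorem ae_condDistrib (hX : Measurable X) (hY : Measurable Y) {p : α × β → Prop}
    (h : ∀ᵐ x ∂μ, p (X x, Y x)) (hp : MeasurableSet {z | p z}) :
    ∀ᵐ a ∂(μ.map X), ∀ᵐ b ∂(condDistrib Y X μ a), p (a, b) := by
  have : IsProbabilityMeasure (μ.map X) := Measure.isProbabilityMeasure_map hX.aemeasurable
  apply Measure.ae_ae_of_ae_compProd
  rw [compProd_map_condDistrib hY.aemeasurable, ae_map_iff (hX.prodMk hY).aemeasurable hp]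
  exact h

theorem measure_preimage_inter_condDistrib (hX : Measurable X) (hY : Measurable Y)
    {C : Set α} {D : Set β} (hC : MeasurableSet C) (hD : MeasurableSet D) :
    μ (X ⁻¹' C ∩ Y ⁻¹' D) = ∫⁻ p in C, condDistrib Y X μ p D ∂(μ.map X) := by
  classical
  have h := lintegral_condDistrib (μ := μ) hX hY
    (f := fun p y => (C ×ˢ D).indicator 1 (p, y))
    (measurable_one.indicator (hC.prod hD))
  have e1 : (fun x => (C ×ˢ D).indicator (1 : α × β → ℝ≥0∞) (X x, Y x)) =
      (X ⁻¹' C ∩ Y ⁻¹' D).indicator 1 := by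
    ext x
    simp [Set.indicator_apply]
  have e2 : (fun p => ∫⁻ y, (C ×ˢ D).indicator (1 : α × β → ℝ≥0∞) (p, y) ∂(condDistrib Y X μ p)) =
      C.indicator fun p => condDistrib Y X μ p D := by
    ext p
    by_cases hp : p ∈ C
    · rw [Set.indicator_of_mem hp, ← lintegral_indicator_one hD]
      refine lintegral_congr fun y => ?_
      simp [Set.indicator_apply, hp]
    · simp [hp]
  rw [e1, e2, lintegral_indicator_one ((hX hC).inter (hY hD)), lintegral_indicator hC] at h
  exact h

end Disintegration

theorem ae_of_ae_condDistrib {Ω α β : Type*} [MeasurableSpace Ω] [MeasurableSpace α]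
    [MeasurableSpace β] [StandardBorelSpace β] [Nonempty β] {μ : Measure Ω} [IsProbabilityMeasure μ]
    {X : Ω → α} {Y : Ω → β} (hX : Measurable X) (hY : Measurable Y) {p : α × β → Prop}
    (hp : MeasurableSet {z | p z})
    (h : ∀ᵐ a ∂(μ.map X), ∀ᵐ b ∂(condDistrib Y X μ a), p (a, b)) : ∀ᵐ x ∂μ, p (X x, Y x) := by
  have : IsProbabilityMeasure (μ.map X) := Measure.isProbabilityMeasure_map hX.aemeasurable
  have h' := Measure.ae_compProd_of_ae_ae hp h
  rw [compProd_map_condDistrib hY.aemeasurable] at h'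
  exact ae_of_ae_map (hX.prodMk hY).aemeasurable h'

theorem eq_dirac_of_singleton_eq_one {β : Type*} [MeasurableSpace β] [MeasurableSingletonClass β]
    (ν : Measure β) [IsProbabilityMeasure ν] {y : β} (h : ν {y} = 1) : ν = Measure.dirac y := by
  have hc : ∀ᵐ z ∂ν, z = y := by
    rw [← prob_compl_eq_zero_iff (measurableSet_singleton y)] at h
    exact h
  ext B hB
  rw [Measure.dirac_apply' _ hB]
  by_cases hy : y ∈ B
  · rw [Set.indicator_of_mem hy, Pi.one_apply, ← mem_ae_iff_prob_eq_one hB]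
    filter_upwards [hc] with z hz
    rwa [hz]
  · rw [Set.indicator_of_notMem hy, measure_eq_zero_iff_ae_notMem]
    filter_upwards [hc] with z hz
    rwa [hz]

/-! ### Shift and reversal of trajectories -/

section Trajectories

variable {A : Type*}

theorem past_shift (x : ℤ → A) : past (shift x) = appendOutput (past x) (x 0) := by
  funext k
  cases k with
  | zero => simp [past, shift, appendOutput]
  | succ k =>
    simp only [past, shift, appendOutput]
    congr 1

theorem future_shift (x : ℤ → A) : future (shift x) = fun k => future x (k + 1) := by
  funext k
  simp [future, shift]

theorem past_reverse (x : ℤ → A) : past (reverse x) = future x := by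
  funext k
  simp only [past, reverse, future]
  congr 1
  ring

theorem future_reverse (x : ℤ → A) : future (reverse x) = past x := by
  funext k
  simp only [past, reverse, future]

end Trajectories

/-! ### Complexities as entropies of partitions of the trajectory space -/

section Classical

variable {A : Type*} [Countable A] [Nonempty A] [MeasurableSpace A] [DiscreteMeasurableSpace A]
  (P : Measure (ℤ → A)) [IsProbabilityMeasure P]

instance : IsMarkovKernel (futureGivenPast P) := by unfold futureGivenPast; infer_instance

instance : IsProbabilityMeasure (pastLaw P) :=
  Measure.isProbabilityMeasure_map measurable_past.aemeasurable

instance : IsProbabilityMeasure (futureLaw P) :=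
  Measure.isProbabilityMeasure_map measurable_future.aemeasurable

/-- The regular conditional distribution `P(past | future)`. -/
noncomputable def pastGivenFuture : Kernel (ℕ → A) (ℕ → A) := condDistrib past future P

instance : IsMarkovKernel (pastGivenFuture P) := by unfold pastGivenFuture; infer_instance

/-- Reversal exchanges past and future, and `condDistrib` depends only on the joint law, so the
equality holds everywhere and not merely almost everywhere. -/
theorem futureGivenPast_timeReversal :
    futureGivenPast (timeReversal P) = pastGivenFuture P := by
  have h : (timeReversal P).map (fun x => (past x, future x)) =
      P.map fun x => (future x, past x) := by
    unfold timeReversal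
    rw [Measure.map_map (measurable_past.prodMk measurable_future) measurable_reverse]
    congr 1
    funext x
    simp [past_reverse, future_reverse]
  unfold futureGivenPast pastGivenFuture
  rw [condDistrib, condDistrib]
  congr

/-- Puts the causal states on the trajectory space, where functions of the past and of the future
can be compared by `shannonEntropy_fiber_congr`. -/
theorem statisticalComplexity_eq :
    statisticalComplexity P = shannonEntropy fun ν => P {x | futureGivenPast P (past x) = ν} := by
  have h : causalProb P = fun s => P {x | causalState P (past x) = s} := by
    funext s
    induction s using Quotient.inductionOn with
    | h p =>
      have hs : {q | causalState P q = Quotient.mk (causalSetoid P) p} =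
          {q | futureGivenPast P q = futureGivenPast P p} := by
        ext q
        exact Quotient.eq (r := causalSetoid P)
      unfold causalProb pastLaw
      rw [Measure.map_apply measurable_past]
      · rfl
      · rw [hs]
        exact measurableSet_kernel_eq _ _
  unfold statisticalComplexity
  rw [h]
  refine shannonEntropy_fiber_congr (G := Set.univ) (by simp) fun x _ x' _ => ?_
  exact Quotient.eq (r := causalSetoid P)

theorem statisticalComplexity_timeReversal_eq :
    statisticalComplexity (timeReversal P) =
      shannonEntropy fun ν => P {x | pastGivenFuture P (future x) = ν} := by
  rw [statisticalComplexity_eq]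
  congr 1
  funext ν
  rw [futureGivenPast_timeReversal]
  unfold timeReversal
  rw [Measure.map_apply measurable_reverse]
  · simp only [Set.preimage_ofPred_eq, past_reverse]
  · exact measurable_past (measurableSet_kernel_eq _ _)

/-! ### Deterministic processes -/

omit [Nonempty A] [Countable A] in
theorem measurableSet_word (L : ℕ) (w : Fin L → A) :
    MeasurableSet {y : ℕ → A | ∀ i : Fin L, y i = w i} := by
  have : {y : ℕ → A | ∀ i : Fin L, y i = w i} = ⋂ i : Fin L, {y | y i = w i} := by
    ext y
    simp
  rw [this]
  exact MeasurableSet.iInter fun i =>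
    (show Measurable fun y : ℕ → A => y i from measurable_pi_apply _)
      (measurableSet_singleton (w i))

omit [Nonempty A] in
theorem shannonEntropy_words (ν : Measure (ℕ → A)) [IsProbabilityMeasure ν] (L : ℕ) :
    shannonEntropy (fun w : Fin L → A => ν {y | ∀ i : Fin L, y i = w i}) =
      ∑' w : Fin L → A,
        ENNReal.ofReal (Real.negMulLog (ν {y | ∀ i : Fin L, y i = w i}).toReal) := by
  have hm := measurableSet_word (A := A) L
  unfold shannonEntropy
  rw [if_pos]
  rw [← measure_iUnion _ hm]
  · convert measure_univ (μ := ν)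
    refine Set.eq_univ_of_forall fun y => Set.mem_iUnion.2 ⟨fun i => y i, fun i => rfl⟩
  · intro w w' hww
    refine Set.disjoint_left.2 fun y hy hy' => hww ?_
    funext i
    exact (hy i).symm.trans (hy' i)

theorem eq_zero_or_one_of_negMulLog_eq_zero {r : ℝ≥0∞} (hr : r ≤ 1)
    (h : ENNReal.ofReal (Real.negMulLog r.toReal) = 0) : r = 0 ∨ r = 1 := by
  have hr' : r ≠ ∞ := ne_top_of_le_ne_top ENNReal.one_ne_top hr
  have h1 : r.toReal ≤ 1 := ENNReal.toReal_mono ENNReal.one_ne_top hr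
  have h0 := Real.negMulLog_nonneg ENNReal.toReal_nonneg h1
  have h2 := le_antisymm (ENNReal.ofReal_eq_zero.1 h) h0
  rw [Real.negMulLog, mul_eq_zero, neg_eq_zero, Real.log_eq_zero] at h2
  have h3 := ENNReal.toReal_nonneg (a := r)
  rcases h2 with h2 | h2 | h2 | h2
  · exact Or.inl ((ENNReal.toReal_eq_zero_iff r).1 h2 |>.resolve_right hr')
  · exact Or.inl ((ENNReal.toReal_eq_zero_iff r).1 h2 |>.resolve_right hr')
  · exact Or.inr ((ENNReal.toReal_eq_one_iff r).1 h2)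
  · linarith

/-- Zero entropy forces every word probability to be `0` or `1`. Almost every `y` avoids the
countably many null words, so all its prefixes have probability `1`, and so does their intersection.
-/
theorem ae_singleton_eq_one_of_condEntropy_eq_zero (h : condEntropyFutureGivenPast P = 0) :
    ∀ᵐ p ∂(pastLaw P), ∀ᵐ y ∂(futureGivenPast P p), futureGivenPast P p {y} = 1 := by
  have hm : ∀ (L : ℕ) (w : Fin L → A), MeasurableSet {y : ℕ → A | ∀ i : Fin L, y i = w i} :=
    measurableSet_word
  have key : ∀ L : ℕ, ∀ᵐ p ∂(pastLaw P), ∀ w : Fin L → A,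
      futureGivenPast P p {y | ∀ i : Fin L, y i = w i} = 0 ∨
        futureGivenPast P p {y | ∀ i : Fin L, y i = w i} = 1 := by
    intro L
    have h1 := (iSup_eq_bot (α := ℝ≥0∞)).1 h L
    simp only [shannonEntropy_words] at h1
    rw [bot_eq_zero', lintegral_eq_zero_iff] at h1
    · filter_upwards [h1] with p hp w
      exact eq_zero_or_one_of_negMulLog_eq_zero prob_le_one (ENNReal.tsum_eq_zero.1 hp w)
    · refine Measurable.tsum fun w => ?_
      exact (Real.continuous_negMulLog.measurable.comp
        ((futureGivenPast P).measurable_coe (hm L w)).ennreal_toReal).ennreal_ofReal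
  filter_upwards [ae_all_iff.2 key] with p hp
  have hy : ∀ᵐ y ∂(futureGivenPast P p), ∀ (L : ℕ) (w : Fin L → A),
      futureGivenPast P p {y | ∀ i : Fin L, y i = w i} = 0 → ¬ ∀ i : Fin L, y i = w i := by
    refine ae_all_iff.2 fun L => ae_all_iff.2 fun w => ?_
    by_cases h0 : futureGivenPast P p {y | ∀ i : Fin L, y i = w i} = 0
    · have := measure_eq_zero_iff_ae_notMem.1 h0
      filter_upwards [this] with y hy _ using hy
    · exact Filter.Eventually.of_forall fun y h => absurd h h0
  filter_upwards [hy] with y hy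
  have h1 : ∀ᵐ y' ∂(futureGivenPast P p), ∀ L : ℕ, ∀ i : Fin L, y' i = y i := by
    refine ae_all_iff.2 fun L => ?_
    have := (hp L fun i => y i).resolve_left fun h0 => hy L _ h0 fun i => rfl
    rwa [← mem_ae_iff_prob_eq_one (hm L _)] at this
  rw [← mem_ae_iff_prob_eq_one (measurableSet_singleton y)]
  filter_upwards [h1] with y' h'
  -- A prefix of length `n + 1` is the shortest one that sees coordinate `n`.
  exact funext fun n => h' (n + 1) (Fin.last n)

omit [Nonempty A] in
-- The singleton varies with the point, so its mass is written as that of a section of a measurable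
-- diagonal.
theorem measurableSet_singleton_eq_one (k : Kernel (ℕ → A) (ℕ → A)) [IsMarkovKernel k] :
    MeasurableSet {z : (ℕ → A) × (ℕ → A) | k z.1 {z.2} = 1} := by
  have h := Kernel.measurable_kernel_prodMk_left
    (κ := k.comap (Prod.fst : (ℕ → A) × (ℕ → A) → ℕ → A) measurable_fst)
    (t := {q : ((ℕ → A) × (ℕ → A)) × (ℕ → A) | q.2 = q.1.2})
    (measurableSet_eq_fun measurable_snd (measurable_snd.comp measurable_fst))
  exact h (measurableSet_singleton 1)

theorem statisticalComplexity_eq_timeReversal_of_condEntropy_eq_zero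
    (h : condEntropyFutureGivenPast P = 0) :
    statisticalComplexity P = statisticalComplexity (timeReversal P) := by
  have hm := measurableSet_singleton_eq_one (futureGivenPast P)
  have h1 : ∀ᵐ x ∂P, futureGivenPast P (past x) {future x} = 1 :=
    ae_of_ae_condDistrib measurable_past measurable_future hm
      (ae_singleton_eq_one_of_condEntropy_eq_zero P h)
  have h2 : ∀ᵐ x ∂P, ∀ᵐ p ∂(pastGivenFuture P (future x)), futureGivenPast P p {future x} = 1 :=
    ae_of_ae_map measurable_future.aemeasurable
      (ae_condDistrib measurable_future measurable_past
        (p := fun z => futureGivenPast P z.2 {z.1} = 1) h1 (measurable_swap hm))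
  have huniq : ∀ (ν : Measure (ℕ → A)) [IsProbabilityMeasure ν] (y y' : ℕ → A),
      ν {y} = 1 → ν {y'} = 1 → y = y' := by
    intro ν _ y y' hy hy'
    rw [eq_dirac_of_singleton_eq_one ν hy,
      Measure.dirac_apply' _ (measurableSet_singleton _)] at hy'
    by_contra hne
    simp [hne] at hy'
  rw [statisticalComplexity_eq, statisticalComplexity_timeReversal_eq]
  refine shannonEntropy_fiber_congr (h1.and h2) ?_
  rintro x ⟨hx1, hx2⟩ x' ⟨hx1', hx2'⟩
  have hf : futureGivenPast P (past x) = futureGivenPast P (past x') ↔ future x = future x' := by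
    constructor
    · intro he
      rw [he] at hx1
      exact huniq _ _ _ hx1 hx1'
    · intro he
      rw [eq_dirac_of_singleton_eq_one _ hx1, eq_dirac_of_singleton_eq_one _ hx1', he]
  rw [hf]
  constructor
  · intro he
    rw [he]
  · intro he
    rw [he] at hx2
    -- The common retrodictive law charges a past from which both futures are certain.
    obtain ⟨p, hp, hp'⟩ := (hx2.and hx2').exists
    exact huniq _ _ _ hp hp'

end Classical

/-! ### Unifilarity: updating the conditional future by an observed output -/

section Update

variable {A : Type*} [MeasurableSpace A]

/-- The sequence with its first symbol removed. -/
def tail {A : Type*} (y : ℕ → A) : ℕ → A := fun k => y (k + 1)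

theorem measurable_tail : Measurable (tail : (ℕ → A) → ℕ → A) :=
  measurable_pi_lambda _ fun _ => measurable_pi_apply _

theorem measurable_appendOutput :
    Measurable fun z : (ℕ → A) × A => appendOutput z.1 z.2 := by
  refine measurable_pi_lambda _ fun k => ?_
  cases k with
  | zero => exact measurable_snd
  | succ k => exact (measurable_pi_apply k).comp measurable_fst

theorem measurable_appendOutput_left (a : A) : Measurable fun p => appendOutput p a :=
  measurable_appendOutput.comp measurable_prodMk_right

theorem measurable_head : Measurable fun y : ℕ → A => y 0 := measurable_pi_apply _

theorem measurableSet_head [DiscreteMeasurableSpace A] (a : A) :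
    MeasurableSet {y : ℕ → A | y 0 = a} :=
  measurable_head (measurableSet_singleton a)

/-- The law of the remaining symbols when the first symbol is known to be `a`. -/
noncomputable def update (ν : Measure (ℕ → A)) (a : A) : Measure (ℕ → A) :=
  (ν {y | y 0 = a})⁻¹ • (ν.restrict {y | y 0 = a}).map tail

end Update

section Stationary

variable {A : Type*} [Countable A] [Nonempty A] [MeasurableSpace A] [DiscreteMeasurableSpace A]
  (P : Measure (ℤ → A)) [IsProbabilityMeasure P]

theorem measure_past_inter_future {C D : Set (ℕ → A)} (hC : MeasurableSet C)
    (hD : MeasurableSet D) :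
    P (past ⁻¹' C ∩ future ⁻¹' D) = ∫⁻ p in C, futureGivenPast P p D ∂(pastLaw P) :=
  measure_preimage_inter_condDistrib measurable_past measurable_future hC hD

variable {P}

/-- Both sides integrate over every set `C` of pasts to the same probability: the joint event is
disintegrated once at time `0` and once, after a shift, at time `1`. -/
theorem ae_kernel_append (hP : IsStationary P) (a : A) {B : Set (ℕ → A)} (hB : MeasurableSet B) :
    ∀ᵐ p ∂(pastLaw P), futureGivenPast P p ({y | y 0 = a} ∩ tail ⁻¹' B) =
      futureGivenPast P p {y | y 0 = a} * futureGivenPast P (appendOutput p a) B := by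
  classical
  have ha := measurableSet_head a
  have hk : ∀ {D : Set (ℕ → A)}, MeasurableSet D → Measurable fun p => futureGivenPast P p D :=
    fun hD => (futureGivenPast P).measurable_coe hD
  have hf : Measurable fun p => futureGivenPast P (appendOutput p a) B :=
    (hk hB).comp (measurable_appendOutput_left a)
  refine ae_eq_of_forall_setLIntegral_eq_of_sigmaFinite
    (hk (ha.inter (measurable_tail hB))) ((hk ha).mul hf) fun C hC _ => ?_
  have hC' : MeasurableSet ({p : ℕ → A | p 0 = a} ∩ tail ⁻¹' C) := ha.inter (measurable_tail hC)
  rw [← measure_past_inter_future P hC (ha.inter (measurable_tail hB))]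
  -- The first output is moved from the future into the past by one shift.
  have e1 : (past ⁻¹' C ∩ future ⁻¹' ({y | y 0 = a} ∩ tail ⁻¹' B) : Set (ℤ → A)) =
      shift ⁻¹' (past ⁻¹' ({p : ℕ → A | p 0 = a} ∩ tail ⁻¹' C) ∩ future ⁻¹' B) := by
    ext x
    simp only [Set.mem_inter_iff, Set.mem_preimage, past_shift, future_shift]
    change _ ∧ x 0 = a ∧ _ ↔ (x 0 = a ∧ _) ∧ _
    rw [← and_assoc, and_comm (a := past x ∈ C)]
    rfl
  rw [e1, hP.measure_preimage
    ((measurable_past hC').inter (measurable_future hB)).nullMeasurableSet,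
    measure_past_inter_future P hC' hB]
  have hg : Measurable
      (({p : ℕ → A | p 0 = a} ∩ tail ⁻¹' C).indicator fun p => futureGivenPast P p B) :=
    (hk hB).indicator hC'
  have e2 : ∫⁻ p in {p : ℕ → A | p 0 = a} ∩ tail ⁻¹' C, futureGivenPast P p B ∂(pastLaw P) =
      ∫⁻ x, (C ×ˢ {y : ℕ → A | y 0 = a}).indicator
        (fun z => futureGivenPast P (appendOutput z.1 a) B) (past x, future x) ∂P := by
    rw [← lintegral_indicator hC', pastLaw, lintegral_map hg measurable_past]
    refine (hP.lintegral_comp (hg.comp measurable_past)).symm.trans (lintegral_congr fun x => ?_)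
    simp only [Function.comp_apply, past_shift]
    by_cases hx : x 0 = a
    · by_cases hx' : past x ∈ C
      · rw [Set.indicator_of_mem, Set.indicator_of_mem]
        · simp [hx]
        · exact ⟨hx', hx⟩
        · exact ⟨hx, hx'⟩
      · rw [Set.indicator_of_notMem, Set.indicator_of_notMem]
        · exact fun h => hx' h.1
        · exact fun h => hx' h.2
    · rw [Set.indicator_of_notMem, Set.indicator_of_notMem]
      · exact fun h => hx h.2
      · exact fun h => hx h.1
  rw [e2, lintegral_condDistrib (μ := P) measurable_past measurable_future
    (f := fun p y => (C ×ˢ {y : ℕ → A | y 0 = a}).indicator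
        (fun z => futureGivenPast P (appendOutput z.1 a) B) (p, y))
    ((hf.comp measurable_fst).indicator (hC.prod ha)), ← lintegral_indicator hC]
  refine lintegral_congr fun p => ?_
  by_cases hp : p ∈ C
  · rw [Set.indicator_of_mem hp, mul_comm]
    have e3 : ∀ y, (C ×ˢ {y : ℕ → A | y 0 = a}).indicator
        (fun z => futureGivenPast P (appendOutput z.1 a) B) (p, y) =
        ({y : ℕ → A | y 0 = a}).indicator
          (fun _ => futureGivenPast P (appendOutput p a) B) y := by
      intro y
      by_cases hy : y 0 = a
      · rw [Set.indicator_of_mem (show (p, y) ∈ C ×ˢ _ from ⟨hp, hy⟩),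
          Set.indicator_of_mem (by exact hy)]
      · rw [Set.indicator_of_notMem (fun h => hy h.2), Set.indicator_of_notMem (by exact hy)]
    simp only [e3]
    exact lintegral_indicator_const ha _
  · rw [Set.indicator_of_notMem hp]
    have e3 : ∀ y, (C ×ˢ {y : ℕ → A | y 0 = a}).indicator
        (fun z => futureGivenPast P (appendOutput z.1 a) B) (p, y) = 0 :=
      fun y => Set.indicator_of_notMem (fun h => hp h.1) _
    simp [e3]

/-- Unifilarity: the causal state and the next symbol determine the next causal state. -/
theorem ae_futureGivenPast_append (hP : IsStationary P) :
    ∀ᵐ p ∂(pastLaw P), ∀ a, outputProb P p a ≠ 0 →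
      futureGivenPast P (appendOutput p a) = update (futureGivenPast P p) a := by
  refine ae_all_iff.2 fun a => ?_
  have h := ae_eq_of_forall_measurableSet (μ := pastLaw P)
    (f := fun p => ((futureGivenPast P p).restrict {y | y 0 = a}).map tail)
    (g := fun p => futureGivenPast P p {y | y 0 = a} • futureGivenPast P (appendOutput p a))
    (fun p => inferInstance) fun B hB => ?_
  · filter_upwards [h] with p hp h0
    unfold update
    rw [hp, smul_smul, ← outputProb, ENNReal.inv_mul_cancel h0 (measure_ne_top _ _), one_smul]
  · filter_upwards [ae_kernel_append hP a hB] with p hp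
    rw [Measure.map_apply measurable_tail hB, Measure.restrict_apply (measurable_tail hB),
      Set.inter_comm, hp, Measure.smul_apply, smul_eq_mul]

/-- The alphabet is countable, so the outputs of conditional probability `0` together form a null
event. -/
theorem ae_outputProb_ne_zero : ∀ᵐ x ∂P, outputProb P (past x) (x 0) ≠ 0 := by
  have h : ∀ p : ℕ → A, ∀ᵐ y ∂(futureGivenPast P p), outputProb P p (y 0) ≠ 0 := by
    intro p
    have : ∀ᵐ y ∂(futureGivenPast P p), ∀ a, outputProb P p a = 0 → y 0 ≠ a := by
      refine ae_all_iff.2 fun a => ?_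
      by_cases h0 : outputProb P p a = 0
      · filter_upwards [measure_eq_zero_iff_ae_notMem.1 h0] with y hy _ using hy
      · exact Filter.Eventually.of_forall fun y h => absurd h h0
    filter_upwards [this] with y hy h0
    exact hy _ h0 rfl
  have hm : ∀ a, Measurable fun p => outputProb P p a := fun a =>
    (futureGivenPast P).measurable_coe (measurableSet_head a)
  have hm2 : Measurable fun z : (ℕ → A) × A => outputProb P z.1 z.2 :=
    measurable_from_prod_countable_left hm
  have hm3 : Measurable fun z : (ℕ → A) × (ℕ → A) => outputProb P z.1 (z.2 0) :=
    hm2.comp (measurable_fst.prodMk (measurable_head.comp measurable_snd))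
  exact ae_of_ae_condDistrib (μ := P) measurable_past measurable_future
    (p := fun z => outputProb P z.1 (z.2 0) ≠ 0)
    (hm3 (measurableSet_singleton 0)).compl (Filter.Eventually.of_forall h)

end Stationary

/-! ### Von Neumann entropy of an ensemble with one overlapping pair -/

/-- The roots `(m₁ + m₂ ± D) / 2` keep the sum but lie further apart, so `m₁` and `m₂` are strict
convex combinations of them with exchanged weights. Adding the two strict concavity inequalities
gives the claim. `c > 0` gives strictness and `c ≤ 1` keeps the smaller root nonnegative. -/
theorem exists_roots_negMulLog_lt {m₁ m₂ c : ℝ} (h₁ : 0 < m₁) (h₂ : 0 < m₂) (h₁₂ : m₁ + m₂ ≤ 1)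
    (hc : 0 < c) (hc1 : c ≤ 1) :
    ∃ a b : ℝ, (∀ l, (l - m₁) * (l - m₂) = m₁ * m₂ * c ^ 2 → l = a ∨ l = b) ∧
      0 ≤ a ∧ a ≤ 1 ∧ 0 ≤ b ∧ b ≤ 1 ∧
      Real.negMulLog a + Real.negMulLog b < Real.negMulLog m₁ + Real.negMulLog m₂ := by
  set D := Real.sqrt ((m₁ - m₂) ^ 2 + 4 * (m₁ * m₂ * c ^ 2)) with hD
  have hp : 0 < m₁ * m₂ := mul_pos h₁ h₂
  have hpc : 0 < m₁ * m₂ * c ^ 2 := by positivity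
  have hpc1 : m₁ * m₂ * c ^ 2 ≤ m₁ * m₂ := mul_le_of_le_one_right hp.le (pow_le_one₀ hc.le hc1)
  have hDsq : D ^ 2 = (m₁ - m₂) ^ 2 + 4 * (m₁ * m₂ * c ^ 2) := Real.sq_sqrt (by positivity)
  have hD0 : 0 < D := Real.sqrt_pos.2 (by positivity)
  have hDτ : D ≤ m₁ + m₂ := (abs_le_of_sq_le_sq' (by nlinarith) (by linarith)).2
  have hDlt : |m₁ - m₂| < D := abs_lt_of_sq_lt_sq (by linarith) hD0.le
  obtain ⟨hD1, hD2⟩ := abs_lt.1 hDlt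
  refine ⟨(m₁ + m₂ + D) / 2, (m₁ + m₂ - D) / 2, fun l hl => ?_, by linarith, by linarith,
    by linarith, by linarith, ?_⟩
  · have : (l - (m₁ + m₂ + D) / 2) * (l - (m₁ + m₂ - D) / 2) = 0 := by nlinarith
    rcases mul_eq_zero.1 this with h | h
    · exact Or.inl (by linarith)
    · exact Or.inr (by linarith)
  · have key : ∀ t s : ℝ, 0 < t → 0 < s → t + s = 1 →
        t * Real.negMulLog ((m₁ + m₂ + D) / 2) + s * Real.negMulLog ((m₁ + m₂ - D) / 2) <
          Real.negMulLog (t * ((m₁ + m₂ + D) / 2) + s * ((m₁ + m₂ - D) / 2)) := by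
      intro t s ht hs hts
      exact Real.strictConcaveOn_negMulLog.2 (show (0 : ℝ) ≤ _ by linarith)
        (show (0 : ℝ) ≤ _ by linarith) (by linarith) ht hs hts
    -- The weights solve `t a + s b = m₁` with `t + s = 1`.
    have ht : 0 < (D + (m₁ - m₂)) / (2 * D) := div_pos (by linarith) (by linarith)
    have hs : 0 < (D - (m₁ - m₂)) / (2 * D) := div_pos (by linarith) (by linarith)
    have hts : (D + (m₁ - m₂)) / (2 * D) + (D - (m₁ - m₂)) / (2 * D) = 1 := by
      field_simp
      ring
    have k1 := key _ _ ht hs hts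
    have k2 := key _ _ hs ht (by rw [add_comm]; exact hts)
    have e1 : (D + (m₁ - m₂)) / (2 * D) * ((m₁ + m₂ + D) / 2) +
        (D - (m₁ - m₂)) / (2 * D) * ((m₁ + m₂ - D) / 2) = m₁ := by
      field_simp
      ring
    have e2 : (D - (m₁ - m₂)) / (2 * D) * ((m₁ + m₂ + D) / 2) +
        (D + (m₁ - m₂)) / (2 * D) * ((m₁ + m₂ - D) / 2) = m₂ := by
      field_simp
      ring
    rw [e1] at k1
    rw [e2] at k2
    have e3 := congrArg (· * Real.negMulLog ((m₁ + m₂ + D) / 2)) hts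
    have e4 := congrArg (· * Real.negMulLog ((m₁ + m₂ - D) / 2)) hts
    nlinarith

section Entropy

variable {H : Type*} [NormedAddCommGroup H] [InnerProductSpace ℂ H] {S : Type*}

/-- The family `s` diagonalizes `ρ` with weights `w`, except for the two indices `i₁` and `i₂`,
whose vectors have the overlap `c`. -/
structure NearlyDiagonal (ρ : H →L[ℂ] H) (s : S → H) (w : S → ℝ) (i₁ i₂ : S) (c : ℝ) : Prop where
  eq_zero : ∀ v, (∀ j, inner ℂ (s j) v = 0) → ρ v = 0
  inner_of_ne : ∀ j, j ≠ i₁ → j ≠ i₂ → ∀ v, inner ℂ (s j) (ρ v) = w j * inner ℂ (s j) v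
  inner_left : ∀ v, inner ℂ (s i₁) (ρ v) =
    w i₁ * inner ℂ (s i₁) v + w i₂ * c * inner ℂ (s i₂) v
  inner_right : ∀ v, inner ℂ (s i₂) (ρ v) =
    w i₁ * c * inner ℂ (s i₁) v + w i₂ * inner ℂ (s i₂) v

variable {ρ : H →L[ℂ] H} {s : S → H} {w : S → ℝ} {i₁ i₂ : S} {c : ℝ}

/-- The overlaps with `s i₁` and `s i₂` satisfy a 2×2 linear system. Off its characteristic roots
the first overlap vanishes, and the first always forces the second since `w i₂ * c ≠ 0`. Once all
overlaps vanish, `ρ v = 0`, contradicting `l ≠ 0` unless `v = 0`. -/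
theorem NearlyDiagonal.eq_zero_of_eigenvector (h : NearlyDiagonal ρ s w i₁ i₂ c)
    (hw₂ : w i₂ ≠ 0) (hc : c ≠ 0) {l : ℝ} (hl : l ≠ 0) {v : H} (hv : ρ v = (l : ℂ) • v)
    (hT : ∀ j, j ≠ i₁ → j ≠ i₂ → w j = l → inner ℂ (s j) v = 0)
    (hz : inner ℂ (s i₁) v = 0 ∨ (l - w i₁) * (l - w i₂) ≠ w i₁ * w i₂ * c ^ 2) : v = 0 := by
  have hlC : (l : ℂ) ≠ 0 := Complex.ofReal_ne_zero.2 hl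
  have hwC : (w i₂ : ℂ) ≠ 0 := Complex.ofReal_ne_zero.2 hw₂
  have hcC : (c : ℂ) ≠ 0 := Complex.ofReal_ne_zero.2 hc
  have e1 := h.inner_left v
  have e2 := h.inner_right v
  rw [hv, inner_smul_right] at e1 e2
  have hz1 : inner ℂ (s i₁) v = 0 := by
    refine hz.elim id fun hz => ?_
    have hz' : ((l : ℂ) - w i₁) * (l - w i₂) - w i₁ * w i₂ * c ^ 2 ≠ 0 := by
      rw [sub_ne_zero]
      exact_mod_cast hz
    have : (((l : ℂ) - w i₁) * (l - w i₂) - w i₁ * w i₂ * c ^ 2) * inner ℂ (s i₁) v = 0 := by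
      linear_combination ((l : ℂ) - w i₂) * e1 + w i₂ * c * e2
    exact (mul_eq_zero.1 this).resolve_left hz'
  have hz2 : inner ℂ (s i₂) v = 0 := by
    rw [hz1, mul_zero, mul_zero, zero_add] at e1
    exact (mul_eq_zero.1 e1.symm).resolve_left (mul_ne_zero hwC hcC)
  have hρ : ρ v = 0 := by
    refine h.eq_zero v fun j => ?_
    by_cases h1 : j = i₁
    · rw [h1, hz1]
    by_cases h2 : j = i₂
    · rw [h2, hz2]
    by_cases h3 : w j = l
    · exact hT j h1 h2 h3
    have e := h.inner_of_ne j h1 h2 v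
    rw [hv, inner_smul_right] at e
    have h3' : (l : ℂ) - w j ≠ 0 := by
      rw [sub_ne_zero]
      exact_mod_cast Ne.symm h3
    exact (mul_eq_zero.1 (show ((l : ℂ) - w j) * inner ℂ (s j) v = 0 by
      linear_combination e)).resolve_left h3'
  rw [hv] at hρ
  exact (smul_eq_zero.1 hρ).resolve_left hlC

/-- An eigenvector is determined by its overlaps with the vectors of weight `l`, plus the overlap
with `s i₁` when `l` is a root. The subset of `Unit` is that optional extra coordinate. -/
theorem NearlyDiagonal.finrank_eigenspace_le (h : NearlyDiagonal ρ s w i₁ i₂ c)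
    (hw₂ : w i₂ ≠ 0) (hc : c ≠ 0) {a b : ℝ}
    (hab : ∀ l, (l - w i₁) * (l - w i₂) = w i₁ * w i₂ * c ^ 2 → l = a ∨ l = b)
    {l : ℝ} (hl : l ≠ 0) (hfin : {j | j ≠ i₁ ∧ j ≠ i₂ ∧ w j = l}.Finite) :
    Module.finrank ℂ (Module.End.eigenspace (ρ : H →ₗ[ℂ] H) (l : ℂ)) ≤
      {j | j ≠ i₁ ∧ j ≠ i₂ ∧ w j = l}.ncard + {_u : Unit | l = a ∨ l = b}.ncard := by
  set T := {j | j ≠ i₁ ∧ j ≠ i₂ ∧ w j = l} with hTdef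
  set E := {_u : Unit | l = a ∨ l = b} with hEdef
  have : Finite T := hfin
  have := Fintype.ofFinite T
  have := Fintype.ofFinite E
  let Φ : Module.End.eigenspace (ρ : H →ₗ[ℂ] H) (l : ℂ) →ₗ[ℂ] (T → ℂ) × (E → ℂ) :=
    ((LinearMap.pi fun j : T => (innerSL ℂ (s j)).toLinearMap).prod
      (LinearMap.pi fun _ : E => (innerSL ℂ (s i₁)).toLinearMap)).comp
        (Submodule.subtype _)
  have hΦ : Function.Injective Φ := by
    rw [injective_iff_map_eq_zero]
    rintro ⟨v, hv⟩ hv0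
    have hv' : ρ v = (l : ℂ) • v := Module.End.mem_eigenspace_iff.1 hv
    have hT0 : ∀ j : T, inner ℂ (s j) v = 0 := fun j => congrFun (congrArg Prod.fst hv0) j
    have hE0 : ∀ u : E, inner ℂ (s i₁) v = 0 := fun u => congrFun (congrArg Prod.snd hv0) u
    refine Subtype.ext (h.eq_zero_of_eigenvector hw₂ hc hl hv'
      (fun j h1 h2 h3 => hT0 ⟨j, h1, h2, h3⟩) ?_)
    by_cases hr : l = a ∨ l = b
    · exact Or.inl (hE0 ⟨(), hr⟩)
    · exact Or.inr fun h => hr (hab l h)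
  refine (LinearMap.finrank_le_finrank_of_injective hΦ).trans (le_of_eq ?_)
  rw [Module.finrank_prod, Module.finrank_fintype_fun_eq_card, Module.finrank_fintype_fun_eq_card,
    ← Nat.card_eq_fintype_card, ← Nat.card_eq_fintype_card]
  rfl

open Classical in
theorem NearlyDiagonal.vonNeumannEntropy_le (h : NearlyDiagonal ρ s w i₁ i₂ c)
    (hw₂ : w i₂ ≠ 0) (hc : c ≠ 0) {a b : ℝ}
    (hab : ∀ l, (l - w i₁) * (l - w i₂) = w i₁ * w i₂ * c ^ 2 → l = a ∨ l = b)
    (hfin : ∀ l : ℝ, l ≠ 0 → {j | w j = l}.Finite) :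
    vonNeumannEntropy ρ ≤
      (∑' j, if j ≠ i₁ ∧ j ≠ i₂ then ENNReal.ofReal (Real.negMulLog (w j)) else 0) +
        (ENNReal.ofReal (Real.negMulLog a) + ENNReal.ofReal (Real.negMulLog b)) := by
  -- The bound is written with indicators of `l`, so that summing over `l` leaves one term per index
  -- and one per root.
  have hterm : ∀ l : ℝ,
      (Module.finrank ℂ (Module.End.eigenspace (ρ : H →ₗ[ℂ] H) (l : ℂ)) : ℝ≥0∞) *
        ENNReal.ofReal (Real.negMulLog l) ≤
      (∑' j, if l = w j then
          if j ≠ i₁ ∧ j ≠ i₂ then ENNReal.ofReal (Real.negMulLog (w j)) else 0 else 0) +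
        ((if l = a then ENNReal.ofReal (Real.negMulLog a) else 0) +
          (if l = b then ENNReal.ofReal (Real.negMulLog b) else 0)) := by
    intro l
    by_cases hl : l = 0
    · simp [hl]
    have hfin' : {j | j ≠ i₁ ∧ j ≠ i₂ ∧ w j = l}.Finite :=
      (hfin l hl).subset fun j hj => hj.2.2
    have hle : (Module.finrank ℂ (Module.End.eigenspace (ρ : H →ₗ[ℂ] H) (l : ℂ)) : ℝ≥0∞) ≤
        ({j | j ≠ i₁ ∧ j ≠ i₂ ∧ w j = l}.ncard : ℝ≥0∞) +
          ({_u : Unit | l = a ∨ l = b}.ncard : ℝ≥0∞) := by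
      exact_mod_cast h.finrank_eigenspace_le hw₂ hc hab hl hfin'
    refine (mul_le_mul_left hle _).trans ?_
    rw [add_mul]
    refine add_le_add ?_ ?_
    · rw [Set.ncard_eq_toFinset_card _ hfin', ← nsmul_eq_mul, ← Finset.sum_const]
      refine le_trans (le_of_eq ?_) (ENNReal.sum_le_tsum hfin'.toFinset)
      refine Finset.sum_congr rfl fun j hj => ?_
      obtain ⟨h1, h2, h3⟩ := hfin'.mem_toFinset.1 hj
      rw [if_pos h3.symm, if_pos ⟨h1, h2⟩, h3]
    · by_cases ha : l = a
      · rw [if_pos ha, ← ha]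
        refine le_add_right ?_
        refine (mul_le_mul_left ?_ _).trans (one_mul _).le
        exact_mod_cast Set.ncard_le_one_of_subsingleton _
      · by_cases hb : l = b
        · rw [if_pos hb, ← hb]
          refine le_add_left ?_
          refine (mul_le_mul_left ?_ _).trans (one_mul _).le
          exact_mod_cast Set.ncard_le_one_of_subsingleton _
        · simp [ha, hb]
  refine (ENNReal.tsum_le_tsum hterm).trans (le_of_eq ?_)
  rw [ENNReal.tsum_add, ENNReal.tsum_add, ENNReal.tsum_comm]
  congr 1
  · exact tsum_congr fun j => tsum_ite_eq _ _
  · rw [tsum_ite_eq, tsum_ite_eq]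

end Entropy

/-! ### Memory vectors -/

section Vectors

/-- The memory of a `QuantumModel` must live in `Type`, whatever the universe of the alphabet;
countability allows shrinking the index set. -/
theorem exists_hilbertBasis_of_countable (J : Type*) [Countable J] :
    ∃ (H : Type) (_ : NormedAddCommGroup H) (_ : InnerProductSpace ℂ H) (_ : CompleteSpace H),
      Nonempty (HilbertBasis J ℂ H) := by
  refine ⟨lp (fun _ : Shrink.{0} J => ℂ) 2, inferInstance, inferInstance, inferInstance, ?_⟩
  let b : HilbertBasis (Shrink.{0} J) ℂ (lp (fun _ : Shrink.{0} J => ℂ) 2) :=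
    HilbertBasis.ofRepr (LinearIsometryEquiv.refl ℂ _)
  refine ⟨HilbertBasis.mk (v := b ∘ equivShrink.{0} J)
    (b.orthonormal.comp _ (equivShrink.{0} J).injective) ?_⟩
  rw [EquivLike.range_comp b (equivShrink.{0} J), b.dense_span]

variable {J : Type*} {H : Type*} [NormedAddCommGroup H] [InnerProductSpace ℂ H]

theorem hasSum_norm_inner_sq (b : HilbertBasis J ℂ H) (v : H) :
    HasSum (fun j => ‖inner ℂ (b j) v‖ ^ 2) (‖v‖ ^ 2) := by
  have h := b.hasSum_inner_mul_inner v v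
  rw [inner_self_eq_norm_sq_to_K] at h
  rw [← Complex.hasSum_ofReal]
  convert! h using 1
  · funext j
    rw [← inner_conj_symm v (b j), Complex.conj_mul']
    push_cast
    rfl
  · push_cast
    rfl

theorem exists_inner_eq (b : HilbertBasis J ℂ H) {f : J → ℝ}
    (hf : Summable fun j => f j ^ 2) : ∃ v : H, ∀ j, inner ℂ (b j) v = f j := by
  have hmem : Memℓp (fun j => (f j : ℂ)) 2 := by
    refine memℓp_gen ?_
    simpa using hf
  refine ⟨b.repr.symm ⟨_, hmem⟩, fun j => ?_⟩
  rw [← b.repr_apply_apply, LinearIsometryEquiv.apply_symm_apply]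

variable {A S : Type*}

/-- The amplitude of the basis vector `(x, j)` in the memory vector `i`: the output `x` is
superposed with amplitude `√(q i x)` and remembers only the label `h x i` of the state. -/
noncomputable def amplitude (q : S → A → ℝ) (h : A → S → S) (i : S) (z : A × S) : ℝ :=
  open Classical in if z.2 = h z.1 i then √(q i z.1) else 0

variable {q : S → A → ℝ} {h : A → S → S}

/-- Each vector is supported on the graph of `x ↦ (x, h x i)`, so two of them overlap only at
outputs where the labels agree. -/
theorem hasSum_amplitude_mul (i i' : S) {r : ℝ} :
    HasSum (fun z => amplitude q h i z * amplitude q h i' z) r ↔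
      HasSum (fun x => open Classical in
        if h x i = h x i' then √(q i x) * √(q i' x) else 0) r := by
  classical
  have hinj : Function.Injective fun x => (x, h x i) := fun x x' hx => congrArg Prod.fst hx
  rw [← hinj.hasSum_iff]
  · refine Iff.of_eq (congrArg (HasSum · r) (funext fun x => ?_))
    by_cases hx : h x i = h x i' <;> simp [amplitude, hx]
  · rintro ⟨x, j⟩ hz
    have : j ≠ h x i := fun hj => hz ⟨x, by rw [hj]⟩
    simp [amplitude, this]

theorem hasSum_amplitude_sq (hq0 : ∀ i x, 0 ≤ q i x) (hq : ∀ i, HasSum (q i) 1) (i : S) :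
    HasSum (fun z => amplitude q h i z ^ 2) 1 := by
  simp only [pow_two]
  rw [hasSum_amplitude_mul]
  simpa [Real.mul_self_sqrt (hq0 i _)] using hq i

theorem inner_eq_of_amplitude (b : HilbertBasis (A × S) ℂ H) {s : S → H}
    (hs : ∀ i z, inner ℂ (b z) (s i) = amplitude q h i z) {i i' : S} {r : ℝ}
    (hr : HasSum (fun x => open Classical in
        if h x i = h x i' then √(q i x) * √(q i' x) else 0) r) :
    inner ℂ (s i) (s i') = (r : ℂ) := by
  have h1 := b.hasSum_inner_mul_inner (s i) (s i')
  have h2 := Complex.hasSum_ofReal.2 ((hasSum_amplitude_mul i i').2 hr)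
  refine h1.unique ?_
  convert! h2 using 1
  funext z
  rw [← inner_conj_symm, hs, hs, Complex.conj_ofReal]
  push_cast
  rfl

end Vectors

/-! ### Causal states of positive probability -/

section States

variable {A : Type*} [Countable A] [Nonempty A] [MeasurableSpace A] [DiscreteMeasurableSpace A]
  (P : Measure (ℤ → A)) [IsProbabilityMeasure P]

/-- The probability that the conditional law of the future is `ν`. -/
noncomputable def stateMass (ν : Measure (ℕ → A)) : ℝ≥0∞ :=
  pastLaw P {p | futureGivenPast P p = ν}

theorem stateMass_eq (ν : Measure (ℕ → A)) :
    stateMass P ν = P {x | futureGivenPast P (past x) = ν} := by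
  unfold stateMass pastLaw
  rw [Measure.map_apply measurable_past (measurableSet_kernel_eq _ _)]
  rfl

/-- The causal states of positive probability, each identified with its conditional future. -/
abbrev RecurrentState : Type _ := {ν : Measure (ℕ → A) // stateMass P ν ≠ 0}

variable {P}

theorem tsum_stateMass (hC : statisticalComplexity P ≠ ⊤) : ∑' ν, stateMass P ν = 1 := by
  simp only [stateMass_eq]
  rw [statisticalComplexity_eq] at hC
  unfold shannonEntropy at hC
  by_contra h
  exact hC (if_neg h)

theorem statisticalComplexity_eq_tsum (hC : statisticalComplexity P ≠ ⊤) :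
    statisticalComplexity P =
      ∑' i : RecurrentState P, ENNReal.ofReal (Real.negMulLog (stateMass P i.1).toReal) := by
  have h := tsum_stateMass hC
  simp only [stateMass_eq] at h
  rw [statisticalComplexity_eq]
  unfold shannonEntropy
  rw [if_pos h]
  simp only [← stateMass_eq]
  refine (Function.Injective.tsum_eq (Subtype.val_injective) fun ν hν => ?_).symm
  exact ⟨⟨ν, fun h0 => hν (by simp [h0])⟩, rfl⟩

theorem countable_recurrentState (hC : statisticalComplexity P ≠ ⊤) :
    Countable (RecurrentState P) := by
  have h : ∑' ν, stateMass P ν ≠ ⊤ := by simp [tsum_stateMass hC]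
  exact (Summable.countable_support_ennreal h).to_subtype

theorem ae_stateMass_ne_zero (hC : statisticalComplexity P ≠ ⊤) :
    ∀ᵐ p ∂(pastLaw P), stateMass P (futureGivenPast P p) ≠ 0 := by
  have := countable_recurrentState hC
  have hm : ∀ i : RecurrentState P, MeasurableSet {p | futureGivenPast P p = i.1} :=
    fun i => measurableSet_kernel_eq _ _
  have hU : pastLaw P (⋃ i : RecurrentState P, {p | futureGivenPast P p = i.1}) = 1 := by
    rw [measure_iUnion _ hm, ← tsum_stateMass hC]
    · refine Function.Injective.tsum_eq (f := stateMass P) (Subtype.val_injective) fun ν hν => ?_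
      exact ⟨⟨ν, hν⟩, rfl⟩
    · intro i j hij
      exact Set.disjoint_left.2 fun p hp hp' => hij (Subtype.ext (hp.symm.trans hp'))
  rw [← mem_ae_iff_prob_eq_one (MeasurableSet.iUnion hm)] at hU
  filter_upwards [hU] with p hp
  obtain ⟨i, hi⟩ := Set.mem_iUnion.1 hp
  rw [show futureGivenPast P p = i.1 from hi]
  exact i.2

theorem nonempty_recurrentState (hC : statisticalComplexity P ≠ ⊤) :
    Nonempty (RecurrentState P) := by
  obtain ⟨p, hp⟩ := (ae_stateMass_ne_zero hC).exists
  exact ⟨⟨_, hp⟩⟩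

/-- The recurrent state with conditional future `ν`, or an arbitrary one. -/
noncomputable def toState [Nonempty (RecurrentState P)] (ν : Measure (ℕ → A)) :
    RecurrentState P :=
  open Classical in if h : stateMass P ν ≠ 0 then ⟨ν, h⟩ else Classical.arbitrary _

theorem toState_of_ne_zero [Nonempty (RecurrentState P)] {ν : Measure (ℕ → A)}
    (h : stateMass P ν ≠ 0) : (toState ν : RecurrentState P).1 = ν := by
  unfold toState
  rw [dif_pos h]

/-- The fibre is the set of pasts in state `i`, enlarged, for the default state only, by the pasts
in no recurrent state. -/
theorem measurableSet_toState_eq [Countable (RecurrentState P)] [Nonempty (RecurrentState P)]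
    (i : RecurrentState P) :
    MeasurableSet {p | (toState (futureGivenPast P p) : RecurrentState P) = i} := by
  have hm : ∀ j : RecurrentState P, MeasurableSet {p | futureGivenPast P p = j.1} :=
    fun j => measurableSet_kernel_eq _ _
  have h : {p | (toState (futureGivenPast P p) : RecurrentState P) = i} =
      {p | futureGivenPast P p = i.1} ∪
        {p | p ∉ ⋃ j : RecurrentState P, {p | futureGivenPast P p = j.1} ∧
          i = Classical.arbitrary _} := by
    ext p
    by_cases hp : stateMass P (futureGivenPast P p) = 0
    · have h1 : (toState (futureGivenPast P p) : RecurrentState P) = Classical.arbitrary _ := by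
        unfold toState
        rw [dif_neg (not_not.2 hp)]
      have h2 : p ∉ ⋃ j : RecurrentState P, {p | futureGivenPast P p = j.1} := by
        intro h
        obtain ⟨j, hj⟩ := Set.mem_iUnion.1 h
        exact j.2 (by rw [← show futureGivenPast P p = j.1 from hj, hp])
      have h3 : futureGivenPast P p ≠ i.1 := fun h => i.2 (by rw [← h, hp])
      change (toState (futureGivenPast P p) : RecurrentState P) = i ↔
        futureGivenPast P p = i.1 ∨ (_ ∧ _)
      rw [h1]
      exact ⟨fun h => Or.inr ⟨h2, h.symm⟩, fun h => (h.resolve_left h3).2.symm⟩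
    · have h1 := toState_of_ne_zero hp
      change (toState (futureGivenPast P p) : RecurrentState P) = i ↔
        futureGivenPast P p = i.1 ∨ (_ ∧ _)
      constructor
      · intro h
        exact Or.inl (by rw [← h, h1])
      · rintro (h | ⟨h, _⟩)
        · exact Subtype.ext (h1.trans h)
        · exact (h (Set.mem_iUnion.2 ⟨(⟨_, hp⟩ : RecurrentState P), rfl⟩)).elim
  rw [h]
  refine (hm i).union ?_
  by_cases hi : i = Classical.arbitrary _
  · simp only [hi, and_true]
    exact (MeasurableSet.iUnion hm).compl
  · simp [hi]

theorem pastLaw_toState_eq (hC : statisticalComplexity P ≠ ⊤) [Nonempty (RecurrentState P)]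
    (i : RecurrentState P) :
    pastLaw P {p | (toState (futureGivenPast P p) : RecurrentState P) = i} =
      stateMass P i.1 := by
  refine measure_congr ?_
  filter_upwards [ae_stateMass_ne_zero hC] with p hp
  refine propext ⟨fun h => ?_, fun h => Subtype.ext ((toState_of_ne_zero hp).trans h)⟩
  change futureGivenPast P p = i.1
  rw [← show (toState (futureGivenPast P p) : RecurrentState P) = i from h,
    toState_of_ne_zero hp]

end States

/-! ### The average of a discrete ensemble -/

section Average

variable {α S H : Type*} [MeasurableSpace α] {μ : Measure α} [IsProbabilityMeasure μ]
  [Countable S] [NormedAddCommGroup H] [InnerProductSpace ℂ H] {idx : α → S}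

omit [InnerProductSpace ℂ H] in
theorem stronglyMeasurable_comp_of_countable (hidx : ∀ i, MeasurableSet {p | idx p = i})
    (s : S → H) : StronglyMeasurable fun p => s (idx p) := by
  let _ : MeasurableSpace S := ⊤
  have h : Measurable idx := measurable_to_countable' hidx
  exact (StronglyMeasurable.of_discrete (f := s)).comp_measurable h

omit [Countable S] in
theorem integral_comp_eq_of_support_pair (hidx : ∀ i, MeasurableSet {p | idx p = i}) (F : S → ℂ)
    {j j' : S} (hjj : j ≠ j') (hF : ∀ i, i ≠ j → i ≠ j' → F i = 0) :
    ∫ p, F (idx p) ∂μ = μ.real {p | idx p = j} * F j + μ.real {p | idx p = j'} * F j' := by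
  classical
  have h : (fun p => F (idx p)) = fun p => {p | idx p = j}.indicator (fun _ => F j) p +
      {p | idx p = j'}.indicator (fun _ => F j') p := by
    funext p
    by_cases h1 : idx p = j
    · have h2 : idx p ≠ j' := h1 ▸ hjj
      simp [h1, hjj]
    · by_cases h2 : idx p = j'
      · simp [h2, hjj.symm]
      · simp [h1, h2, hF _ h1 h2]
  rw [h, integral_add ((integrable_const _).indicator (hidx j))
    ((integrable_const _).indicator (hidx j')), integral_indicator_const _ (hidx j),
    integral_indicator_const _ (hidx j')]
  simp

omit [Countable S] [IsProbabilityMeasure μ] in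
theorem integral_comp_eq_of_support_singleton (hidx : ∀ i, MeasurableSet {p | idx p = i})
    (F : S → ℂ) {j : S} (hF : ∀ i, i ≠ j → F i = 0) :
    ∫ p, F (idx p) ∂μ = μ.real {p | idx p = j} * F j := by
  classical
  have h : (fun p => F (idx p)) = {p | idx p = j}.indicator (fun _ => F j) := by
    funext p
    by_cases h1 : idx p = j
    · simp [h1]
    · simp [h1, hF _ h1]
  rw [h, integral_indicator_const _ (hidx j)]
  simp

theorem integral_rankOne_apply (hidx : ∀ i, MeasurableSet {p | idx p = i}) {s : S → H}
    (hs : ∀ i, ‖s i‖ = 1) (v : H) :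
    (∫ p, InnerProductSpace.rankOne ℂ (s (idx p)) (s (idx p)) ∂μ) v =
      ∫ p, inner ℂ (s (idx p)) v • s (idx p) ∂μ := by
  have hint : Integrable (fun p => InnerProductSpace.rankOne ℂ (s (idx p)) (s (idx p))) μ := by
    refine Integrable.of_bound (C := 1) (stronglyMeasurable_comp_of_countable hidx
      (fun i => InnerProductSpace.rankOne ℂ (s i) (s i))).aestronglyMeasurable
      (Filter.Eventually.of_forall fun p => ?_)
    simp [hs]
  rw [ContinuousLinearMap.integral_apply hint]
  rfl

theorem inner_integral_rankOne_apply [CompleteSpace H]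
    (hidx : ∀ i, MeasurableSet {p | idx p = i}) {s : S → H}
    (hs : ∀ i, ‖s i‖ = 1) (u v : H) :
    inner ℂ u ((∫ p, InnerProductSpace.rankOne ℂ (s (idx p)) (s (idx p)) ∂μ) v) =
      ∫ p, inner ℂ (s (idx p)) v * inner ℂ u (s (idx p)) ∂μ := by
  rw [integral_rankOne_apply hidx hs, ← integral_inner]
  · simp only [inner_smul_right]
  · refine Integrable.of_bound (C := ‖v‖) (stronglyMeasurable_comp_of_countable hidx
      (fun i => inner ℂ (s i) v • s i)).aestronglyMeasurable
      (Filter.Eventually.of_forall fun p => ?_)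
    rw [norm_smul, hs, mul_one]
    exact (norm_inner_le_norm _ _).trans (by rw [hs, one_mul])

/-- Pairing with `s j` annihilates every cell of the ensemble whose vector is orthogonal to `s j`,
leaving one cell, or two for the overlapping pair. -/
theorem nearlyDiagonal_integral [CompleteSpace H]
    (hidx : ∀ i, MeasurableSet {p | idx p = i}) {s : S → H}
    (hs : ∀ i, ‖s i‖ = 1) {i₁ i₂ : S} (hne : i₁ ≠ i₂) {c : ℝ} (hc : inner ℂ (s i₁) (s i₂) = (c : ℂ))
    (horth : ∀ i j, i ≠ j → ¬ (i = i₁ ∧ j = i₂) → ¬ (i = i₂ ∧ j = i₁) →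
      inner ℂ (s i) (s j) = 0) :
    NearlyDiagonal (∫ p, InnerProductSpace.rankOne ℂ (s (idx p)) (s (idx p)) ∂μ) s
      (fun j => μ.real {p | idx p = j}) i₁ i₂ c where
  eq_zero v hv := by
    rw [integral_rankOne_apply hidx hs]
    simp [hv]
  inner_of_ne j h1 h2 v := by
    rw [inner_integral_rankOne_apply hidx hs,
      integral_comp_eq_of_support_singleton hidx
        (fun i => inner ℂ (s i) v * inner ℂ (s j) (s i)) (j := j)]
    · simp [inner_self_eq_norm_sq_to_K, hs]
    · intro i hi
      rw [horth j i hi.symm (fun h => h1 h.1) (fun h => h2 h.1), mul_zero]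
  inner_left v := by
    rw [inner_integral_rankOne_apply hidx hs,
      integral_comp_eq_of_support_pair hidx
        (fun i => inner ℂ (s i) v * inner ℂ (s i₁) (s i)) hne]
    · simp only [inner_self_eq_norm_sq_to_K, hs, hc]
      push_cast
      ring
    · intro i h1 h2
      rw [horth i₁ i h1.symm (fun h => h2 h.2) (fun h => hne h.1), mul_zero]
  inner_right v := by
    have hc' : inner ℂ (s i₂) (s i₁) = (c : ℂ) := by
      rw [← inner_conj_symm, hc, Complex.conj_ofReal]
    rw [inner_integral_rankOne_apply hidx hs,
      integral_comp_eq_of_support_pair hidx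
        (fun i => inner ℂ (s i) v * inner ℂ (s i₂) (s i)) hne]
    · simp only [inner_self_eq_norm_sq_to_K, hs, hc']
      push_cast
      ring
    · intro i h1 h2
      rw [horth i₂ i h2.symm (fun h => hne h.1.symm) (fun h => h1 h.2), mul_zero]

end Average

/-! ### A quantum model that merges two histories -/

section Merge

/-- The label remembered together with the output `x` in state `i`: the state itself, except that
the output `x₀` of `i₂` is remembered as if it came from `i₁`. -/
noncomputable def mergeLabel {A S : Type*} (i₁ i₂ : S) (x₀ x : A) (i : S) : S :=
  open Classical in if i = i₂ ∧ x = x₀ then i₁ else i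

theorem mergeLabel_eq_iff {A S : Type*} {i₁ i₂ : S} {x₀ x : A} {i j : S} (hij : i ≠ j)
    (h : mergeLabel i₁ i₂ x₀ x i = mergeLabel i₁ i₂ x₀ x j) :
    x = x₀ ∧ ((i = i₁ ∧ j = i₂) ∨ (i = i₂ ∧ j = i₁)) := by
  unfold mergeLabel at h
  split_ifs at h with h1 h2 h2
  · exact absurd (h1.1.trans h2.1.symm) hij
  · exact ⟨h1.2, Or.inr ⟨h1.1, h.symm⟩⟩
  · exact ⟨h2.2, Or.inl ⟨h, h2.1⟩⟩
  · exact absurd h hij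

variable {A S H : Type*} [NormedAddCommGroup H] [InnerProductSpace ℂ H] {q : S → A → ℝ}
  {i₁ i₂ : S} {x₀ : A}

theorem hasSum_of_eq_single {ι : Type*} {f : ι → ℝ} {i : ι} {r : ℝ} (hi : f i = r)
    (h0 : ∀ j, j ≠ i → f j = 0) : HasSum f r :=
  hi ▸ hasSum_single i h0

theorem norm_eq_one_of_amplitude (b : HilbertBasis (A × S) ℂ H) (hq0 : ∀ i x, 0 ≤ q i x)
    (hq : ∀ i, HasSum (q i) 1) {h : A → S → S} {s : S → H}
    (hs : ∀ i z, inner ℂ (b z) (s i) = amplitude q h i z) (i : S) : ‖s i‖ = 1 := by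
  have h1 : inner ℂ (s i) (s i) = ((1 : ℝ) : ℂ) := by
    refine inner_eq_of_amplitude b hs ?_
    simpa [Real.mul_self_sqrt (hq0 i _)] using hq i
  have h2 : ‖s i‖ ^ 2 = 1 := by
    rw [norm_sq_eq_re_inner (𝕜 := ℂ), h1]
    simp
  nlinarith [norm_nonneg (s i)]

theorem inner_merge_of_ne (b : HilbertBasis (A × S) ℂ H) {s : S → H}
    (hs : ∀ i z, inner ℂ (b z) (s i) = amplitude q (mergeLabel i₁ i₂ x₀) i z) {i j : S}
    (hij : i ≠ j) (h1 : ¬ (i = i₁ ∧ j = i₂)) (h2 : ¬ (i = i₂ ∧ j = i₁)) :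
    inner ℂ (s i) (s j) = 0 := by
  rw [inner_eq_of_amplitude (r := 0) b hs, Complex.ofReal_zero]
  convert hasSum_zero using 2 with x
  rw [if_neg]
  intro h
  exact (mergeLabel_eq_iff hij h).2.elim h1 h2

/-- Only `x₀` is merged, even if other outputs could be, so a single explicit overlap arises. -/
theorem inner_merge (b : HilbertBasis (A × S) ℂ H) {s : S → H} (hne : i₁ ≠ i₂)
    (hs : ∀ i z, inner ℂ (b z) (s i) = amplitude q (mergeLabel i₁ i₂ x₀) i z) :
    inner ℂ (s i₁) (s i₂) = ((√(q i₁ x₀) * √(q i₂ x₀) : ℝ) : ℂ) := by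
  refine inner_eq_of_amplitude b hs ?_
  refine hasSum_of_eq_single (i := x₀) ?_ ?_
  · rw [if_pos]
    simp [mergeLabel, hne]
  · intro x hx
    rw [if_neg]
    exact fun h => hx (mergeLabel_eq_iff hne h).1

open Classical in
/-- Given the output `a`, look up the label `j` numbered `k` and prepare the state that follows
`j` after the output `a`. -/
noncomputable def mergeKraus (e : S → ℕ) (b : A × S → H) (s : S → H) (δ : S → A → S) (a : A) (k : ℕ) :
    H →L[ℂ] H :=
  if h : ∃ j, e j = k then
    InnerProductSpace.rankOne ℂ (s (δ h.choose a)) (b (a, h.choose)) else 0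

theorem mergeKraus_apply {e : S → ℕ} (he : Function.Injective e) (b : A × S → H) (s : S → H)
    (δ : S → A → S) (a : A)
    (j : S) : mergeKraus e b s δ a (e j) =
      InnerProductSpace.rankOne ℂ (s (δ j a)) (b (a, j)) := by
  have h : ∃ j', e j' = e j := ⟨j, rfl⟩
  unfold mergeKraus
  rw [dif_pos h, he h.choose_spec]

theorem mergeKraus_eq_zero {e : S → ℕ} (b : A × S → H) (s : S → H) (δ : S → A → S) (a : A)
    {k : ℕ} (hk : k ∉ Set.range e) : mergeKraus e b s δ a k = 0 :=
  dif_neg hk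

end Merge

/-! ### The merged model has strictly smaller entropy -/

section Model

variable {A : Type*} [Countable A] [Nonempty A] [MeasurableSpace A] [DiscreteMeasurableSpace A]
  {P : Measure (ℤ → A)} [IsProbabilityMeasure P]

/-- The probability of the next output in a recurrent state. -/
noncomputable def stateOutput (i : RecurrentState P) (x : A) : ℝ := (i.1 {y | y 0 = x}).toReal

theorem isProbabilityMeasure_recurrentState (i : RecurrentState P) :
    IsProbabilityMeasure i.1 := by
  obtain ⟨p, hp⟩ := nonempty_of_measure_ne_zero i.2
  rw [← show futureGivenPast P p = i.1 from hp]
  infer_instance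

theorem hasSum_stateOutput (i : RecurrentState P) : HasSum (stateOutput i) 1 := by
  have := isProbabilityMeasure_recurrentState i
  have h : ∑' x : A, i.1 {y | y 0 = x} = 1 := by
    rw [← measure_iUnion _ fun x => measurableSet_head x]
    · convert measure_univ (μ := i.1)
      exact Set.eq_univ_of_forall fun y => Set.mem_iUnion.2 ⟨y 0, rfl⟩
    · intro x x' hxx
      exact Set.disjoint_left.2 fun y hy hy' => hxx (Eq.trans (Eq.symm hy) hy')
  have h2 := ENNReal.hasSum_toReal (f := fun x : A => i.1 {y | y 0 = x}) (by simp [h])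
  rwa [← ENNReal.tsum_toReal_eq fun x => measure_ne_top _ _, h] at h2

theorem stateOutput_nonneg (i : RecurrentState P) (x : A) : 0 ≤ stateOutput i x :=
  ENNReal.toReal_nonneg

theorem stateOutput_le_one (i : RecurrentState P) (x : A) : stateOutput i x ≤ 1 :=
  have := isProbabilityMeasure_recurrentState i
  ENNReal.toReal_mono ENNReal.one_ne_top prob_le_one

theorem exists_quantumModel_entropy_lt (hP : IsStationary P) (hC : statisticalComplexity P ≠ ⊤)
    {i₁ i₂ : RecurrentState P} (hne : i₁ ≠ i₂) {x₀ : A} (h₁ : i₁.1 {y | y 0 = x₀} ≠ 0)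
    (h₂ : i₂.1 {y | y 0 = x₀} ≠ 0) (hu : update i₁.1 x₀ = update i₂.1 x₀) :
    ∃ Q : QuantumModel P, Q.entropy < statisticalComplexity P := by
  classical
  have := countable_recurrentState hC
  have := nonempty_recurrentState hC
  obtain ⟨e, he⟩ := exists_injective_nat (RecurrentState P)
  obtain ⟨H, _, _, _, ⟨b⟩⟩ := exists_hilbertBasis_of_countable (A × RecurrentState P)
  set h := mergeLabel i₁ i₂ x₀ with hh
  have hq0 := stateOutput_nonneg (P := P)
  have hq := hasSum_stateOutput (P := P)
  choose s hs using fun i => exists_inner_eq b (hasSum_amplitude_sq (h := h) hq0 hq i).summable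
  have hnorm : ∀ i, ‖s i‖ = 1 := norm_eq_one_of_amplitude b hq0 hq hs
  let δ : RecurrentState P → A → RecurrentState P := fun j a => toState (update j.1 a)
  -- The forgotten label is harmless: by `hu`, both merged histories lead to the same next state.
  have hδ : ∀ a i, δ (h a i) a = δ i a := by
    intro a i
    rw [hh]
    unfold mergeLabel
    split_ifs with hi
    · obtain ⟨rfl, rfl⟩ := hi
      exact congrArg toState hu
    · rfl
  let idx : (ℕ → A) → RecurrentState P := fun p => toState (futureGivenPast P p)
  have hidx : ∀ i, MeasurableSet {p | idx p = i} := measurableSet_toState_eq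
  let K := mergeKraus e b s δ
  have hKn : ∀ a j ψ, ‖K a (e j) ψ‖ ^ 2 = ‖inner ℂ (b (a, j)) ψ‖ ^ 2 := by
    intro a j ψ
    rw [show K a (e j) = _ from mergeKraus_apply he b s δ a j, InnerProductSpace.rankOne_apply,
      norm_smul, hnorm, mul_one]
  have hK0 : ∀ a k, k ∉ Set.range e → K a k = 0 := fun a k hk => mergeKraus_eq_zero b s δ a hk
  let Q : QuantumModel P :=
    { H := H
      state := fun p => s (idx p)
      norm_state := fun p => hnorm _
      stronglyMeasurable_state := stronglyMeasurable_comp_of_countable hidx s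
      kraus := K
      trace_preserving := by
        intro ψ
        have hinj : Function.Injective fun z : A × RecurrentState P => (z.1, e z.2) := by
          rintro ⟨a, j⟩ ⟨a', j'⟩ hz
          obtain ⟨ha, hj⟩ := Prod.mk.inj hz
          exact Prod.ext ha (he hj)
        rw [← hinj.hasSum_iff]
        · convert! hasSum_norm_inner_sq b ψ using 1
          funext z
          exact hKn z.1 z.2 ψ
        · rintro ⟨a, k⟩ hz
          have hk : k ∉ Set.range e := fun ⟨j, hj⟩ => hz ⟨(a, j), Prod.ext rfl hj⟩
          simp [hK0 a k hk]
      output := by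
        filter_upwards [ae_stateMass_ne_zero hC] with p hp a
        have hout : (outputProb P p a).toReal = stateOutput (idx p) a := by
          unfold outputProb stateOutput
          rw [toState_of_ne_zero hp]
        rw [hout, ← he.hasSum_iff]
        · refine hasSum_of_eq_single (i := h a (idx p)) ?_ ?_
          · simp only [Function.comp_apply]
            rw [hKn, hs]
            simp [amplitude, Real.sq_sqrt (hq0 _ _)]
          · intro j hj
            simp only [Function.comp_apply]
            rw [hKn, hs]
            simp [amplitude, hj]
        · intro k hk
          simp [hK0 a k hk]
      transition := by
        filter_upwards [ae_stateMass_ne_zero hC, ae_futureGivenPast_append hP] with p hp hp' a ha k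
        by_cases hk : k ∈ Set.range e
        · obtain ⟨j, rfl⟩ := hk
          have hnext : idx (appendOutput p a) = δ (idx p) a := by
            change toState _ = toState _
            rw [hp' a ha, toState_of_ne_zero hp]
          rw [show K a (e j) = _ from mergeKraus_apply he b s δ a j,
            InnerProductSpace.rankOne_apply, hs]
          by_cases hj : j = h a (idx p)
          · rw [hj, hδ, hnext]
            exact Submodule.smul_mem _ _ (Submodule.mem_span_singleton_self _)
          · simp [amplitude, hj]
        · simp [hK0 a k hk] }
  refine ⟨Q, ?_⟩
  set c : ℝ := √(stateOutput i₁ x₀) * √(stateOutput i₂ x₀) with hc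
  have hpos : ∀ i : RecurrentState P, i.1 {y | y 0 = x₀} ≠ 0 → 0 < √(stateOutput i x₀) := by
    intro i hi
    have := isProbabilityMeasure_recurrentState i
    exact Real.sqrt_pos.2 (ENNReal.toReal_pos hi (measure_ne_top _ _))
  have hc0 : 0 < c := mul_pos (hpos i₁ h₁) (hpos i₂ h₂)
  have hc1 : c ≤ 1 := mul_le_one₀ (Real.sqrt_le_one.2 (stateOutput_le_one _ _))
    (Real.sqrt_nonneg _) (Real.sqrt_le_one.2 (stateOutput_le_one _ _))
  have hdiag := nearlyDiagonal_integral (μ := pastLaw P) hidx hnorm hne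
    (inner_merge b hne hs) fun i j hij hi hj => inner_merge_of_ne b hs hij hi hj
  have hw : ∀ j, (pastLaw P).real {p | idx p = j} = (stateMass P j.1).toReal := fun j =>
    congrArg ENNReal.toReal (pastLaw_toState_eq hC j)
  simp only [hw] at hdiag
  have hmtop : ∀ j : RecurrentState P, stateMass P j.1 ≠ ⊤ := fun j => measure_ne_top _ _
  have hmpos : ∀ j : RecurrentState P, 0 < (stateMass P j.1).toReal := fun j =>
    ENNReal.toReal_pos j.2 (hmtop j)
  have hsum : ∑' j : RecurrentState P, stateMass P j.1 ≤ 1 :=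
    (ENNReal.tsum_comp_le_tsum_of_injective Subtype.val_injective _).trans
      (tsum_stateMass hC).le
  have hsum' : ∑' j : RecurrentState P, stateMass P j.1 ≠ ⊤ :=
    ne_top_of_le_ne_top ENNReal.one_ne_top hsum
  have hpair : (stateMass P i₁.1).toReal + (stateMass P i₂.1).toReal ≤ 1 := by
    rw [← ENNReal.toReal_add (hmtop _) (hmtop _)]
    refine ENNReal.toReal_mono ENNReal.one_ne_top (le_trans ?_ hsum)
    have := ENNReal.sum_le_tsum (f := fun j : RecurrentState P => stateMass P j.1) {i₁, i₂}
    rwa [Finset.sum_pair hne] at this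
  obtain ⟨r, t, hroots, hr0, hr1, ht0, ht1, hlt⟩ :=
    exists_roots_negMulLog_lt (hmpos i₁) (hmpos i₂) hpair hc0 hc1
  -- A summable family has only finitely many terms of size at least `|l|`.
  have hfin : ∀ l : ℝ, l ≠ 0 → {j : RecurrentState P | (stateMass P j.1).toReal = l}.Finite := by
    intro l hl
    have := ENNReal.finite_const_le_of_tsum_ne_top hsum' (ε := ENNReal.ofReal |l|) (by simpa)
    refine this.subset fun j hj => ?_
    have hj' : (stateMass P j.1).toReal = l := hj
    change ENNReal.ofReal |l| ≤ stateMass P j.1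
    rw [← hj', abs_of_pos (hmpos j), ENNReal.ofReal_toReal (hmtop j)]
  have hle := hdiag.vonNeumannEntropy_le (hmpos i₂).ne' hc0.ne' hroots hfin
  refine hle.trans_lt ?_
  have hCsum := statisticalComplexity_eq_tsum hC
  rw [hCsum]
  rw [hCsum] at hC
  set g : RecurrentState P → ℝ≥0∞ :=
    fun j => ENNReal.ofReal (Real.negMulLog (stateMass P j.1).toReal) with hg
  have hsplit : ∑' j, g j = (∑' j, if j ≠ i₁ ∧ j ≠ i₂ then g j else 0) + (g i₁ + g i₂) := by
    have : ∀ j, g j = (if j ≠ i₁ ∧ j ≠ i₂ then g j else 0) +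
        ((if j = i₁ then g i₁ else 0) + (if j = i₂ then g i₂ else 0)) := by
      intro j
      by_cases hj1 : j = i₁
      · simp [hj1, hne]
      · by_cases hj2 : j = i₂
        · simp [hj2, hne.symm]
        · simp [hj1, hj2]
    rw [tsum_congr this, ENNReal.tsum_add, ENNReal.tsum_add, tsum_ite_eq, tsum_ite_eq]
  rw [hsplit] at hC ⊢
  -- The part shared by both entropies is finite, since `hC` says the whole sum is, and so it can be
  -- cancelled.
  suffices hrt : ENNReal.ofReal (Real.negMulLog r) + ENNReal.ofReal (Real.negMulLog t) <
      g i₁ + g i₂ by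
    convert! ENNReal.add_lt_add_left (ENNReal.add_ne_top.1 hC).1 hrt
  have hmle : ∀ j : RecurrentState P, (stateMass P j.1).toReal ≤ 1 := fun j =>
    ENNReal.toReal_mono ENNReal.one_ne_top prob_le_one
  rw [hg, ← ENNReal.ofReal_add (Real.negMulLog_nonneg hr0 hr1) (Real.negMulLog_nonneg ht0 ht1),
    ← ENNReal.ofReal_add (Real.negMulLog_nonneg (hmpos _).le (hmle _))
      (Real.negMulLog_nonneg (hmpos _).le (hmle _))]
  refine (ENNReal.ofReal_lt_ofReal_iff_of_nonneg ?_).2 hlt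
  exact add_nonneg (Real.negMulLog_nonneg hr0 hr1) (Real.negMulLog_nonneg ht0 ht1)

/-- If quantum memory gives no advantage, then an output and the causal state that follows it
determine the causal state before it. -/
theorem eq_of_update_eq (hP : IsStationary P) (hC : statisticalComplexity P ≠ ⊤)
    (hq : quantumComplexity P = statisticalComplexity P) (i₁ i₂ : RecurrentState P) (x₀ : A)
    (h₁ : i₁.1 {y | y 0 = x₀} ≠ 0) (h₂ : i₂.1 {y | y 0 = x₀} ≠ 0)
    (hu : update i₁.1 x₀ = update i₂.1 x₀) : i₁ = i₂ := by
  by_contra hne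
  obtain ⟨Q, hQ⟩ := exists_quantumModel_entropy_lt hP hC hne h₁ h₂ hu
  rw [← hq] at hQ
  exact absurd hQ (not_lt.2 (iInf_le _ Q))

end Model

/-! ### The future determines the causal state -/

section Regular

theorem iterate_shift_apply {A : Type*} (n : ℕ) (x : ℤ → A) (t : ℤ) :
    shift^[n] x t = x (t + n) := by
  induction n generalizing x with
  | zero => simp
  | succ n ih =>
    rw [Function.iterate_succ_apply, ih, shift]
    congr 1
    push_cast
    ring

/-- The first `L` symbols of a future, read backwards from time `L`. -/
def lookBack {A : Type*} (L : ℕ) (y : ℕ → A) : ℕ → A := fun k => y (L - 1 - k)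

theorem measurable_lookBack {A : Type*} [MeasurableSpace A] (L : ℕ) :
    Measurable (lookBack L : (ℕ → A) → ℕ → A) :=
  measurable_pi_lambda _ fun _ => measurable_pi_apply _

theorem past_iterate_shift {A : Type*} {L k : ℕ} (hk : k < L) (x : ℤ → A) :
    past (shift^[L] x) k = lookBack L (future x) k := by
  simp only [past, iterate_shift_apply, lookBack, future]
  congr 1
  omega

variable {A : Type*} [Countable A] [Nonempty A] [MeasurableSpace A] [DiscreteMeasurableSpace A]
  (P : Measure (ℤ → A)) [IsProbabilityMeasure P]

/-- At every time `n ≥ 0` the causal state has positive probability, emits the next output with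
positive probability, and is updated accordingly. -/
def IsRegular (x : ℤ → A) : Prop :=
  ∀ n : ℕ, stateMass P (futureGivenPast P (past (shift^[n] x))) ≠ 0 ∧
    outputProb P (past (shift^[n] x)) (shift^[n] x 0) ≠ 0 ∧
    futureGivenPast P (past (shift (shift^[n] x))) =
      update (futureGivenPast P (past (shift^[n] x))) (shift^[n] x 0)

variable {P}

theorem IsRegular.shift {x : ℤ → A} (hx : IsRegular P x) : IsRegular P (shift x) := fun n => by
  simpa only [Function.iterate_succ_apply] using hx (n + 1)

theorem ae_isRegular (hP : IsStationary P) (hC : statisticalComplexity P ≠ ⊤) :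
    ∀ᵐ x ∂P, IsRegular P x := by
  have h1 : ∀ᵐ x ∂P, stateMass P (futureGivenPast P (past x)) ≠ 0 :=
    ae_of_ae_map measurable_past.aemeasurable (ae_stateMass_ne_zero hC)
  have h2 := ae_outputProb_ne_zero (P := P)
  have h3 : ∀ᵐ x ∂P, ∀ a, outputProb P (past x) a ≠ 0 →
      futureGivenPast P (appendOutput (past x) a) = update (futureGivenPast P (past x)) a :=
    ae_of_ae_map measurable_past.aemeasurable (ae_futureGivenPast_append hP)
  have h : ∀ᵐ x ∂P, stateMass P (futureGivenPast P (past x)) ≠ 0 ∧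
      outputProb P (past x) (x 0) ≠ 0 ∧
      futureGivenPast P (past (shift x)) = update (futureGivenPast P (past x)) (x 0) := by
    filter_upwards [h1, h2, h3] with x hx1 hx2 hx3
    exact ⟨hx1, hx2, by rw [past_shift, hx3 _ hx2]⟩
  exact ae_all_iff.2 fun n => (hP.iterate n).quasiMeasurePreserving.ae h

/-- Going back from time `L`, each common symbol lets `hco` undo one update. -/
theorem IsRegular.eq_of_iterate_eq
    (hco : ∀ (i₁ i₂ : RecurrentState P) (x₀ : A), i₁.1 {y | y 0 = x₀} ≠ 0 →
      i₂.1 {y | y 0 = x₀} ≠ 0 → update i₁.1 x₀ = update i₂.1 x₀ → i₁ = i₂)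
    (L : ℕ) {x x' : ℤ → A} (hx : IsRegular P x) (hx' : IsRegular P x')
    (hw : ∀ k : ℕ, k < L → x k = x' k)
    (hL : futureGivenPast P (past (CausalAsymmetry.shift^[L] x)) =
      futureGivenPast P (past (CausalAsymmetry.shift^[L] x'))) :
    futureGivenPast P (past x) = futureGivenPast P (past x') := by
  induction L generalizing x x' with
  | zero => exact hL
  | succ L ih =>
    have h1 := ih hx.shift hx'.shift (fun k hk => by simpa using! hw (k + 1) (by omega)) hL
    obtain ⟨a1, a2, a3⟩ := hx 0
    obtain ⟨b1, b2, b3⟩ := hx' 0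
    have h0 : x 0 = x' 0 := hw 0 (by omega)
    simp only [Function.iterate_zero, id_eq] at a1 a2 a3 b1 b2 b3
    rw [a3, b3, ← h0] at h1
    rw [← h0] at b2
    exact congrArg Subtype.val (hco ⟨_, a1⟩ ⟨_, b1⟩ (x 0) a2 b2 h1)

/-- The causal state is read off a long enough recent past, with small error. -/
theorem exists_past_decoder (hC : statisticalComplexity P ≠ ⊤) {ε : ℝ≥0∞} (hε : ε ≠ 0) :
    ∃ (L : ℕ) (Z : RecurrentState P → Set (ℕ → A)), (∀ j, MeasurableSet (Z j)) ∧
      (∀ j (p p' : ℕ → A), (∀ k, k < L → p k = p' k) → p ∈ Z j → p' ∈ Z j) ∧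
      pastLaw P {p | ¬ ∀ j, p ∈ Z j ↔ futureGivenPast P p = j.1} ≤ ε := by
  classical
  have := countable_recurrentState hC
  have hm : ∀ i : RecurrentState P, MeasurableSet {p | futureGivenPast P p = i.1} :=
    fun i => measurableSet_kernel_eq _ _
  have hε2 : ε / 2 ≠ 0 := (ENNReal.half_pos hε).ne'
  -- Half of the error pays for neglecting all but finitely many states; the other half for
  -- approximating those by cylinders.
  obtain ⟨F, hF⟩ : ∃ F : Finset (RecurrentState P),
      pastLaw P (⋃ i ∈ F, {p | futureGivenPast P p = i.1})ᶜ ≤ ε / 2 := by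
    have hsum : ∑' i : RecurrentState P, stateMass P i.1 = 1 := by
      rw [← tsum_stateMass hC]
      exact Function.Injective.tsum_eq (f := stateMass P) Subtype.val_injective
        fun ν hν => ⟨⟨ν, hν⟩, rfl⟩
    have hlt : 1 - ε / 2 < ∑' i : RecurrentState P, stateMass P i.1 := by
      rw [hsum]
      exact ENNReal.sub_lt_self ENNReal.one_ne_top one_ne_zero hε2
    rw [ENNReal.tsum_eq_iSup_sum] at hlt
    obtain ⟨F, hF⟩ := lt_iSup_iff.1 hlt
    refine ⟨F, ?_⟩
    rw [prob_compl_eq_one_sub (F.measurableSet_biUnion fun i _ => hm i), measure_biUnion_finset]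
    · exact tsub_le_iff_tsub_le.1 hF.le
    · intro i _ j _ hij
      exact Set.disjoint_left.2 fun p hp hp' => hij (Subtype.ext (Eq.trans (Eq.symm hp) hp'))
    · exact fun i _ => hm i
  have hdense : (pastLaw P).MeasureDense (measurableCylinders fun _ : ℕ => A) :=
    Measure.MeasureDense.of_generateFrom_isSetAlgebra_finite _ isSetAlgebra_measurableCylinders
      generateFrom_measurableCylinders.symm
  obtain ⟨δ, hδ0, hδ⟩ : ∃ δ : ℝ, 0 < δ ∧ F.card * ENNReal.ofReal δ ≤ ε / 2 := by
    obtain ⟨δ, hδ0, hδ⟩ := ENNReal.exists_nnreal_pos_mul_lt (a := F.card) (b := ε / 2)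
      (ENNReal.natCast_ne_top _) hε2
    refine ⟨δ, hδ0, ?_⟩
    rw [ENNReal.ofReal_coe_nnreal, mul_comm]
    exact hδ.le
  choose Z hZ hZδ using fun i : RecurrentState P =>
    hdense.approx _ (hm i) (measure_ne_top _ _) δ hδ0
  choose s T hT hZs using fun i => (mem_measurableCylinders _).1 (hZ i)
  -- The length exceeds every coordinate used by the finitely many cylinders; states outside `F` are
  -- never announced.
  refine ⟨F.sup fun i => (s i).sup id + 1, fun j => if j ∈ F then Z j else ∅, ?_, ?_, ?_⟩
  · intro j
    dsimp only
    split_ifs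
    · exact hdense.measurable _ (hZ j)
    · exact MeasurableSet.empty
  · intro j p p' hpp hp
    dsimp only at hp ⊢
    split_ifs at hp ⊢ with hj
    · rw [hZs, mem_cylinder] at hp ⊢
      convert hp using 1
      funext k
      refine (hpp k ?_).symm
      have h1 : (k : ℕ) ≤ (s j).sup id := Finset.le_sup (f := id) k.2
      have h2 : (s j).sup id + 1 ≤ F.sup fun i => (s i).sup id + 1 :=
        Finset.le_sup (f := fun i => (s i).sup id + 1) hj
      omega
    · exact hp
  · have hsub : {p | ¬ ∀ j, p ∈ (if j ∈ F then Z j else ∅) ↔ futureGivenPast P p = j.1} ⊆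
        (⋃ i ∈ F, {p | futureGivenPast P p = i.1})ᶜ ∪
          ⋃ i ∈ F, symmDiff {p | futureGivenPast P p = i.1} (Z i) := by
      intro p hp
      by_contra hc
      simp only [Set.mem_union, not_or, Set.mem_compl_iff, not_not] at hc
      obtain ⟨hc1, hc2⟩ := hc
      obtain ⟨i, hiF, hi⟩ := Set.mem_iUnion₂.1 hc1
      refine hp fun j => ?_
      by_cases hj : j ∈ F
      · rw [if_pos hj]
        have : p ∉ symmDiff {p | futureGivenPast P p = j.1} (Z j) := fun h =>
          hc2 (Set.mem_iUnion₂.2 ⟨j, hj, h⟩)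
        rw [Set.mem_symmDiff] at this
        change ¬ ((futureGivenPast P p = j.1 ∧ _) ∨ (_ ∧ ¬ futureGivenPast P p = j.1)) at this
        tauto
      · rw [if_neg hj]
        refine ⟨fun h => h.elim, fun h => hj ?_⟩
        have : i = j := Subtype.ext (Eq.trans (Eq.symm hi) h)
        rwa [← this]
    refine (measure_mono hsub).trans ((measure_union_le _ _).trans ?_)
    rw [← ENNReal.add_halves ε]
    refine add_le_add hF ((measure_biUnion_finset_le _ _).trans (le_trans ?_ hδ))
    rw [← nsmul_eq_mul, ← Finset.sum_const]
    exact Finset.sum_le_sum fun i _ => (hZδ i).le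

/-- The last symbols before time `L` decode the state at `L`, and the word `X₀ … X_{L-1}` then leads
back to a unique state at time `0`. The set `D` collects the futures for which this procedure
returns `i`. -/
theorem exists_approx_future_set (hP : IsStationary P) (hC : statisticalComplexity P ≠ ⊤)
    (hco : ∀ (i₁ i₂ : RecurrentState P) (x₀ : A), i₁.1 {y | y 0 = x₀} ≠ 0 →
      i₂.1 {y | y 0 = x₀} ≠ 0 → update i₁.1 x₀ = update i₂.1 x₀ → i₁ = i₂)
    (i : RecurrentState P) {ε : ℝ≥0∞} (hε : ε ≠ 0) :
    ∃ D : Set (ℕ → A), MeasurableSet D ∧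
      P {x | ¬ (futureGivenPast P (past x) = i.1 ↔ future x ∈ D)} ≤ ε := by
  have := countable_recurrentState hC
  obtain ⟨L, Z, hZm, hZL, hZε⟩ := exists_past_decoder hC hε
  let W : RecurrentState P → Set (Fin L → A) := fun j =>
    {w | ∃ x, IsRegular P x ∧ futureGivenPast P (past x) = i.1 ∧
      futureGivenPast P (past (shift^[L] x)) = j.1 ∧ ∀ k : Fin L, x k = w k}
  refine ⟨⋃ j, lookBack L ⁻¹' Z j ∩ (fun y (k : Fin L) => y k) ⁻¹' W j, ?_, ?_⟩
  · refine MeasurableSet.iUnion fun j => (measurable_lookBack L (hZm j)).inter ?_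
    exact (measurable_pi_lambda _ fun k => measurable_pi_apply _)
      (Set.to_countable (W j)).measurableSet
  · have hT : P ((fun x => past (shift^[L] x)) ⁻¹'
        {p | ¬ ∀ j, p ∈ Z j ↔ futureGivenPast P p = j.1}) ≤ ε := by
      obtain ⟨N, hN, hNm, hNe⟩ := exists_measurable_superset (pastLaw P)
        {p | ¬ ∀ j, p ∈ Z j ↔ futureGivenPast P p = j.1}
      refine (measure_mono (Set.preimage_mono hN)).trans (le_trans (le_of_eq ?_) hZε)
      rw [← hNe, pastLaw, Measure.map_apply measurable_past hNm,
        ← (hP.iterate L).measure_preimage (measurable_past hNm).nullMeasurableSet]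
      rfl
    refine le_trans (measure_mono_ae ?_) hT
    filter_upwards [ae_isRegular hP hC] with x hx hbad hgood
    refine hbad ?_
    have hgood' : ∀ j, past (shift^[L] x) ∈ Z j ↔
        futureGivenPast P (past (shift^[L] x)) = j.1 := hgood
    have hback : ∀ j, lookBack L (future x) ∈ Z j ↔ past (shift^[L] x) ∈ Z j := fun j =>
      ⟨hZL j _ _ fun k hk => (past_iterate_shift hk x).symm,
        hZL j _ _ fun k hk => past_iterate_shift hk x⟩
    constructor
    · intro hi
      refine Set.mem_iUnion.2 ⟨⟨_, (hx L).1⟩, ?_, x, hx, hi, rfl, fun k => rfl⟩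
      exact (hback _).2 ((hgood' _).2 rfl)
    · intro hD
      obtain ⟨j, hj, x', hx', hi', hj', hw⟩ := Set.mem_iUnion.1 hD
      have hj1 := (hgood' j).1 ((hback j).1 hj)
      rw [← hi']
      exact hx.eq_of_iterate_eq hco L hx' (fun k hk => (hw ⟨k, hk⟩).symm) (hj1.trans hj'.symm)

/-- With summable errors `2⁻ⁿ`, Borel–Cantelli makes the approximations eventually correct, and `B`
is their lower limit. -/
theorem exists_future_set (hP : IsStationary P) (hC : statisticalComplexity P ≠ ⊤)
    (hco : ∀ (i₁ i₂ : RecurrentState P) (x₀ : A), i₁.1 {y | y 0 = x₀} ≠ 0 →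
      i₂.1 {y | y 0 = x₀} ≠ 0 → update i₁.1 x₀ = update i₂.1 x₀ → i₁ = i₂)
    (i : RecurrentState P) :
    ∃ B : Set (ℕ → A), MeasurableSet B ∧
      ∀ᵐ x ∂P, futureGivenPast P (past x) = i.1 ↔ future x ∈ B := by
  choose D hDm hD using fun n : ℕ =>
    exists_approx_future_set hP hC hco i (ε := 2⁻¹ ^ n) (pow_ne_zero _ (by simp))
  refine ⟨⋃ N, ⋂ n, ⋂ (_ : N ≤ n), D n, MeasurableSet.iUnion fun N =>
    MeasurableSet.iInter fun n => MeasurableSet.iInter fun _ => hDm n, ?_⟩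
  have hsum : ∑' n, P {x | ¬ (futureGivenPast P (past x) = i.1 ↔ future x ∈ D n)} ≠ ⊤ := by
    refine ne_top_of_le_ne_top ?_ (ENNReal.tsum_le_tsum hD)
    rw [ENNReal.tsum_geometric, ENNReal.one_sub_inv_two, inv_inv]
    exact ENNReal.ofNat_ne_top
  filter_upwards [ae_eventually_notMem hsum] with x hx
  obtain ⟨N, hN⟩ := Filter.eventually_atTop.1 hx
  have hN' : ∀ n, N ≤ n → (futureGivenPast P (past x) = i.1 ↔ future x ∈ D n) :=
    fun n hn => not_not.1 (hN n hn)
  constructor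
  · intro hi
    exact Set.mem_iUnion.2 ⟨N, Set.mem_iInter₂.2 fun n hn => (hN' n hn).1 hi⟩
  · intro hB
    obtain ⟨M, hM⟩ := Set.mem_iUnion.1 hB
    exact (hN' (max M N) (le_max_right _ _)).2 (Set.mem_iInter₂.1 hM _ (le_max_left _ _))

end Regular

/-! ### Complexities of a process whose causal states are determined by the future -/

section FutureDetermined

variable {A : Type*} [Countable A] [Nonempty A] [MeasurableSpace A] [DiscreteMeasurableSpace A]
  {P : Measure (ℤ → A)} [IsProbabilityMeasure P]

/-- Past and future are independent given the causal state, since the conditional future is constant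
on it. -/
theorem measure_past_inter_state_inter_future (i : RecurrentState P) {C D : Set (ℕ → A)}
    (hC : MeasurableSet C) (hD : MeasurableSet D) :
    P (past ⁻¹' (C ∩ {p | futureGivenPast P p = i.1}) ∩ future ⁻¹' D) =
      i.1 D * pastLaw P (C ∩ {p | futureGivenPast P p = i.1}) := by
  have hm := hC.inter (measurableSet_kernel_eq (futureGivenPast P) i.1)
  rw [measure_past_inter_future P hm hD, setLIntegral_congr_fun (g := fun _ => i.1 D) hm,
    setLIntegral_const]
  intro p hp
  exact congrArg (fun ν : Measure (ℕ → A) => ν D) hp.2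

variable {B : RecurrentState P → Set (ℕ → A)} (hBm : ∀ i, MeasurableSet (B i))
  (hB : ∀ i, ∀ᵐ x ∂P, futureGivenPast P (past x) = i.1 ↔ future x ∈ B i)
include hBm hB

omit hBm in
theorem measure_past_inter_future_set (i : RecurrentState P) {C D : Set (ℕ → A)}
    (hC : MeasurableSet C) (hD : MeasurableSet D) :
    P (past ⁻¹' C ∩ future ⁻¹' (D ∩ B i)) =
      i.1 D * pastLaw P (C ∩ {p | futureGivenPast P p = i.1}) := by
  rw [← measure_past_inter_state_inter_future i hC hD]
  refine measure_congr ?_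
  filter_upwards [hB i] with x hx
  refine propext ⟨fun h => ⟨⟨h.1, hx.2 h.2.2⟩, h.2.1⟩, fun h => ⟨h.1.1, h.2, hx.1 h.1.2⟩⟩

theorem futureLaw_inter_future_set (i : RecurrentState P) {D : Set (ℕ → A)}
    (hD : MeasurableSet D) : futureLaw P (D ∩ B i) = i.1 D * stateMass P i.1 := by
  have h := measure_past_inter_future_set hB i MeasurableSet.univ hD
  rw [Set.preimage_univ, Set.univ_inter, Set.univ_inter] at h
  rw [futureLaw, Measure.map_apply measurable_future (hD.inter (hBm i)), h]
  rfl

/-- A future in `B i` reveals the state `i` and, by conditional independence, nothing more about the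
past. -/
theorem ae_pastGivenFuture_eq (i : RecurrentState P) :
    ∀ᵐ x ∂P, futureGivenPast P (past x) = i.1 → pastGivenFuture P (future x) =
      (stateMass P i.1)⁻¹ • (pastLaw P).restrict {p | futureGivenPast P p = i.1} := by
  have hQ := measurableSet_kernel_eq (futureGivenPast P) i.1
  have hmass : (stateMass P i.1)⁻¹ * stateMass P i.1 = 1 :=
    ENNReal.inv_mul_cancel i.2 (measure_ne_top _ _)
  have h : ∀ᵐ y ∂((futureLaw P).restrict (B i)), pastGivenFuture P y =
      (stateMass P i.1)⁻¹ • (pastLaw P).restrict {p | futureGivenPast P p = i.1} := by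
    refine ae_eq_of_forall_measurableSet (fun y => inferInstance) fun C hC => ?_
    refine ae_eq_of_forall_setLIntegral_eq_of_sigmaFinite
      ((pastGivenFuture P).measurable_coe hC) measurable_const fun D hD _ => ?_
    rw [setLIntegral_const, Measure.restrict_restrict hD, Measure.restrict_apply hD,
      futureLaw_inter_future_set hBm hB i hD, Measure.smul_apply, Measure.restrict_apply hC,
      smul_eq_mul]
    have h1 : P (future ⁻¹' (D ∩ B i) ∩ past ⁻¹' C) =
        ∫⁻ y in D ∩ B i, pastGivenFuture P y C ∂(futureLaw P) :=
      measure_preimage_inter_condDistrib measurable_future measurable_past (hD.inter (hBm i)) hC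
    rw [← h1, Set.inter_comm, measure_past_inter_future_set hB i hC hD]
    calc i.1 D * pastLaw P (C ∩ {p | futureGivenPast P p = i.1})
        = ((stateMass P i.1)⁻¹ * stateMass P i.1) *
          (i.1 D * pastLaw P (C ∩ {p | futureGivenPast P p = i.1})) := by rw [hmass, one_mul]
      _ = _ := by ring
  rw [ae_restrict_iff' (hBm i)] at h
  filter_upwards [hB i, ae_of_ae_map measurable_future.aemeasurable h] with x hx hx' hi
  exact hx' (hx.1 hi)

/-- The retrodictive laws of different states live on disjoint sets of pasts, so they are distinct
and the two partitions agree. -/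
theorem statisticalComplexity_eq_timeReversal_of_future_set (hC : statisticalComplexity P ≠ ⊤) :
    statisticalComplexity P = statisticalComplexity (timeReversal P) := by
  have := countable_recurrentState hC
  let R : RecurrentState P → Measure (ℕ → A) := fun i =>
    (stateMass P i.1)⁻¹ • (pastLaw P).restrict {p | futureGivenPast P p = i.1}
  have hR : Function.Injective R := by
    intro i j hij
    by_contra hne
    have h := congrArg (fun ν : Measure (ℕ → A) => ν {p | futureGivenPast P p = i.1}) hij
    have hdisj : {p | futureGivenPast P p = i.1} ∩ {p | futureGivenPast P p = j.1} = ∅ :=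
      Set.disjoint_iff_inter_eq_empty.1 (Set.disjoint_left.2 fun p hp hp' =>
        hne (Subtype.ext (Eq.trans (Eq.symm hp) hp')))
    simp only [R, Measure.smul_apply, smul_eq_mul,
      Measure.restrict_apply (measurableSet_kernel_eq (futureGivenPast P) i.1), Set.inter_self,
      hdisj, measure_empty, mul_zero] at h
    exact (mul_ne_zero (ENNReal.inv_ne_zero.2 (measure_ne_top _ _)) i.2) h
  rw [statisticalComplexity_eq, statisticalComplexity_timeReversal_eq]
  refine shannonEntropy_fiber_congr
    (G := {x | ∃ i : RecurrentState P, futureGivenPast P (past x) = i.1 ∧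
      pastGivenFuture P (future x) = R i}) ?_ ?_
  · filter_upwards [ae_of_ae_map measurable_past.aemeasurable (ae_stateMass_ne_zero hC),
      ae_all_iff.2 (ae_pastGivenFuture_eq hBm hB)] with x hx hx'
    exact ⟨⟨_, hx⟩, rfl, hx' ⟨_, hx⟩ rfl⟩
  · rintro x ⟨i, hi, hi'⟩ x' ⟨j, hj, hj'⟩
    rw [hi, hj, hi', hj', hR.eq_iff, Subtype.ext_iff]

/-- The joint law is carried by the blocks (pasts in state `i`) × `B i`. Such a block has mass `πᵢ`,
against `πᵢ²` under the product law, and within it past and future are independent. -/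
theorem jointLaw_eq_withDensity (hC : statisticalComplexity P ≠ ⊤) :
    jointLaw P = ((pastLaw P).prod (futureLaw P)).withDensity fun z =>
      ∑' i : RecurrentState P, ({p | futureGivenPast P p = i.1} ×ˢ B i).indicator
        (fun _ => (stateMass P i.1)⁻¹) z := by
  have := countable_recurrentState hC
  have hQ : ∀ i : RecurrentState P, MeasurableSet {p | futureGivenPast P p = i.1} :=
    fun i => measurableSet_kernel_eq _ _
  have hprob : IsProbabilityMeasure (jointLaw P) :=
    Measure.isProbabilityMeasure_map (measurable_past.prodMk measurable_future).aemeasurable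
  refine Measure.ext_prod fun {C D} hC' hD => ?_
  rw [withDensity_apply _ (hC'.prod hD), lintegral_tsum fun i =>
    (measurable_const.indicator ((hQ i).prod (hBm i))).aemeasurable]
  have hterm : ∀ i : RecurrentState P, ∫⁻ z in C ×ˢ D,
      ({p | futureGivenPast P p = i.1} ×ˢ B i).indicator
        (fun _ => (stateMass P i.1)⁻¹) z ∂((pastLaw P).prod (futureLaw P)) =
      P (past ⁻¹' (C ∩ {p | futureGivenPast P p = i.1}) ∩ future ⁻¹' D) := by
    intro i
    rw [lintegral_indicator_const ((hQ i).prod (hBm i)),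
      Measure.restrict_apply ((hQ i).prod (hBm i)), Set.prod_inter_prod, Measure.prod_prod,
      Set.inter_comm _ C, Set.inter_comm _ D, futureLaw_inter_future_set hBm hB i hD,
      measure_past_inter_state_inter_future i hC' hD]
    calc (stateMass P i.1)⁻¹ * (pastLaw P (C ∩ {p | futureGivenPast P p = i.1}) *
          (i.1 D * stateMass P i.1))
        = ((stateMass P i.1)⁻¹ * stateMass P i.1) *
          (i.1 D * pastLaw P (C ∩ {p | futureGivenPast P p = i.1})) := by ring
      _ = _ := by rw [ENNReal.inv_mul_cancel i.2 (measure_ne_top _ _), one_mul]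
  rw [tsum_congr hterm, ← measure_iUnion]
  · rw [jointLaw, Measure.map_apply (measurable_past.prodMk measurable_future) (hC'.prod hD)]
    refine measure_congr ?_
    filter_upwards [ae_of_ae_map measurable_past.aemeasurable (ae_stateMass_ne_zero hC)] with x hx
    refine propext ⟨fun h => Set.mem_iUnion.2 ⟨(⟨_, hx⟩ : RecurrentState P), ⟨h.1, rfl⟩, h.2⟩,
      fun h => ?_⟩
    obtain ⟨i, hi⟩ := Set.mem_iUnion.1 h
    exact ⟨hi.1.1, hi.2⟩
  · intro i j hij
    exact Set.disjoint_left.2 fun p hp hp' =>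
      hij (Subtype.ext (Eq.trans (Eq.symm hp.1.2) hp'.1.2))
  · exact fun i => (measurable_past (hC'.inter (hQ i))).inter (measurable_future hD)

/-- The log-density equals `-log πᵢ` on state `i`, so its mean is the entropy of the causal states.
-/
theorem excessEntropy_eq_of_future_set (hC : statisticalComplexity P ≠ ⊤) :
    excessEntropy P = statisticalComplexity P := by
  have := countable_recurrentState hC
  have hQ : ∀ i : RecurrentState P, MeasurableSet {p | futureGivenPast P p = i.1} :=
    fun i => measurableSet_kernel_eq _ _
  have hprob : IsProbabilityMeasure (jointLaw P) :=
    Measure.isProbabilityMeasure_map (measurable_past.prodMk measurable_future).aemeasurable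
  set f : (ℕ → A) × (ℕ → A) → ℝ≥0∞ := fun z =>
    ∑' i : RecurrentState P, ({p | futureGivenPast P p = i.1} ×ˢ B i).indicator
        (fun _ => (stateMass P i.1)⁻¹) z with hf
  have hfm : Measurable f := Measurable.tsum fun i =>
    measurable_const.indicator ((hQ i).prod (hBm i))
  have hjoint : jointLaw P = ((pastLaw P).prod (futureLaw P)).withDensity f :=
    jointLaw_eq_withDensity hBm hB hC
  have hac : jointLaw P ≪ (pastLaw P).prod (futureLaw P) := by
    rw [hjoint]
    exact withDensity_absolutelyContinuous _ _
  have hFm : Measurable fun z => Real.log (f z).toReal :=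
    Real.measurable_log.comp hfm.ennreal_toReal
  have hllr : llr (jointLaw P) ((pastLaw P).prod (futureLaw P)) =ᵐ[jointLaw P]
      fun z => Real.log (f z).toReal := by
    have h : (jointLaw P).rnDeriv ((pastLaw P).prod (futureLaw P)) =ᵐ[jointLaw P] f := by
      refine hac.ae_eq ?_
      rw [hjoint]
      exact Measure.rnDeriv_withDensity _ hfm
    filter_upwards [h] with z hz
    rw [llr, hz]
  have hval : ∀ᵐ x ∂P, ∃ i : RecurrentState P, futureGivenPast P (past x) = i.1 ∧
      f (past x, future x) = (stateMass P i.1)⁻¹ := by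
    filter_upwards [ae_of_ae_map measurable_past.aemeasurable (ae_stateMass_ne_zero hC),
      ae_all_iff.2 hB] with x hx hx'
    refine ⟨⟨_, hx⟩, rfl, ?_⟩
    rw [hf]
    dsimp only
    rw [tsum_eq_single (⟨_, hx⟩ : RecurrentState P)]
    · rw [Set.indicator_of_mem]
      exact ⟨rfl, (hx' ⟨_, hx⟩).1 rfl⟩
    · intro j hj
      refine Set.indicator_of_notMem (fun h => hj (Subtype.ext ?_)) _
      exact (Eq.symm h.1)
  have hmle : ∀ i : RecurrentState P, (stateMass P i.1).toReal ≤ 1 := fun i =>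
    ENNReal.toReal_mono ENNReal.one_ne_top prob_le_one
  have hlog : ∀ i : RecurrentState P,
      Real.log ((stateMass P i.1)⁻¹).toReal = -Real.log (stateMass P i.1).toReal := fun i => by
    rw [ENNReal.toReal_inv, Real.log_inv]
  have hpm : AEMeasurable (fun x : ℤ → A => (past x, future x)) P :=
    (measurable_past.prodMk measurable_future).aemeasurable
  have hnonneg : ∀ᵐ z ∂(jointLaw P), 0 ≤ Real.log (f z).toReal := by
    rw [jointLaw, ae_map_iff hpm (measurableSet_le measurable_const hFm)]
    filter_upwards [hval] with x hx
    obtain ⟨i, _, hi⟩ := hx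
    rw [hi, hlog, neg_nonneg]
    exact Real.log_nonpos ENNReal.toReal_nonneg (hmle i)
  have hint : ∫⁻ z, ENNReal.ofReal (Real.log (f z).toReal) ∂(jointLaw P) =
      statisticalComplexity P := by
    rw [jointLaw, lintegral_map hFm.ennreal_ofReal (measurable_past.prodMk measurable_future),
      statisticalComplexity_eq_tsum hC]
    have h : ∀ᵐ x ∂P, ENNReal.ofReal (Real.log (f (past x, future x)).toReal) =
        ∑' i : RecurrentState P, (past ⁻¹' {p | futureGivenPast P p = i.1}).indicator
          (fun _ => ENNReal.ofReal (-Real.log (stateMass P i.1).toReal)) x := by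
      filter_upwards [hval] with x hx
      obtain ⟨i, hi, hi'⟩ := hx
      rw [tsum_eq_single i, Set.indicator_of_mem (by exact hi), hi', hlog]
      intro j hj
      refine Set.indicator_of_notMem (fun h => hj (Subtype.ext ?_)) _
      exact (Eq.symm h).trans hi
    rw [lintegral_congr_ae h, lintegral_tsum fun i =>
      (measurable_const.indicator (measurable_past (hQ i))).aemeasurable]
    refine tsum_congr fun i => ?_
    rw [lintegral_indicator_const (measurable_past (hQ i)),
      show P (past ⁻¹' {p | futureGivenPast P p = i.1}) = stateMass P i.1 from
        (stateMass_eq P i.1).symm, Real.negMulLog, neg_mul, ← mul_neg,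
      ENNReal.ofReal_mul ENNReal.toReal_nonneg, mul_comm,
      ENNReal.ofReal_toReal (show stateMass P i.1 ≠ ⊤ from measure_ne_top _ _)]
  -- Finite complexity is exactly the integrability of the log-density, without which `klDiv` would
  -- be `⊤`.
  have hintegrable : Integrable (fun z => Real.log (f z).toReal) (jointLaw P) := by
    rw [← lintegral_ofReal_ne_top_iff_integrable hFm.aestronglyMeasurable hnonneg, hint]
    exact hC
  rw [excessEntropy, InformationTheory.klDiv_of_ac_of_integrable hac (hintegrable.congr hllr.symm),
    integral_congr_ae hllr, probReal_univ, probReal_univ, add_sub_cancel_right,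
    ofReal_integral_eq_lintegral_ofReal hintegrable hnonneg, hint]

end FutureDetermined

end CausalAsymmetry

theorem mainTheorem9 {A : Type*} [Countable A] [Nonempty A] [MeasurableSpace A]
    [DiscreteMeasurableSpace A] (P : MeasureTheory.Measure (ℤ → A))
    [MeasureTheory.IsProbabilityMeasure P] (hP : CausalAsymmetry.IsStationary P) :
    (CausalAsymmetry.statisticalComplexity P ≠ ⊤ →
      CausalAsymmetry.quantumComplexity P = CausalAsymmetry.statisticalComplexity P →
        CausalAsymmetry.statisticalComplexity P =
            CausalAsymmetry.statisticalComplexity (CausalAsymmetry.timeReversal P) ∧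
          CausalAsymmetry.statisticalComplexity (CausalAsymmetry.timeReversal P) =
            CausalAsymmetry.excessEntropy P) ∧
    (CausalAsymmetry.condEntropyFutureGivenPast P = 0 →
      CausalAsymmetry.statisticalComplexity P =
          CausalAsymmetry.statisticalComplexity (CausalAsymmetry.timeReversal P) ∧
        CausalAsymmetry.causalAsymmetry P = 0) := by
  constructor
  · intro hC hq
    choose B hBm hB using
      CausalAsymmetry.exists_future_set hP hC (CausalAsymmetry.eq_of_update_eq hP hC hq)
    have h1 := CausalAsymmetry.statisticalComplexity_eq_timeReversal_of_future_set hBm hB hC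
    exact ⟨h1, h1 ▸ (CausalAsymmetry.excessEntropy_eq_of_future_set hBm hB hC).symm⟩
  · intro h
    have h1 := CausalAsymmetry.statisticalComplexity_eq_timeReversal_of_condEntropy_eq_zero P h
    refine ⟨h1, ?_⟩
    rw [CausalAsymmetry.causalAsymmetry, ← h1, tsub_self, max_self]
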